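/- Let $R$ be a quasi-local coherent ring, i.e. a commutative ring with a unique maximal ideal $m$ (not necessarily Noetherian) in which every finitely generated ideal is finitely presented, and let $M$ be a nonzero finitely presented $R$-module of finite G-dimension. Then $$\operatorname{depth} M+\operatorname{Gdim}_R M=\operatorname{depth} R ,$$ an equality in $\{0,1,2,\dots\}\cup\{\infty\}$. Here $\operatorname{depth} M$ is the supremum, over all faithfully flat ring extensions $S$ of $R$, of the lengths of the $(M\otimes_R S)$-regular sequences contained in $mS$. A finitely generated $R$-module $G$ belongs to the G-class of $R$ if, with $G^*=\operatorname{Hom}_R(G,R)$, one has $\operatorname{Ext}^i_R(G,R)=0=\operatorname{Ext}^i_R(G^*,R)$ for all $i>0$ and the natural map $G\to G^{**}$ is an isomorphism. A G-resolution of $M$ is an exact sequence $\cdots\to G_1\to G_0\to M\to 0$ with every $G_n$ in the G-class of $R$; its length is the supremum of the $n$ with $G_n\neq 0$ (and $0$ if all $G_n$ vanish). The G-dimension $\operatorname{Gdim}_R M$ is the infimum of the lengths of all G-resolutions of $M$; it is finite if $M$ has a G-resolution of finite length. -/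

import Mathlib

open CategoryTheory RingTheory.Sequence
open scoped TensorProduct

universe u

namespace GorensteinDim

section Definitions

/-- A commutative ring is *coherent* if every finitely generated ideal is finitely presented. -/
def IsCoherentRing (R : Type u) [CommRing R] : Prop :=
  ∀ I : Ideal R, I.FG → Module.FinitePresentation R I

/-- The *classical depth* of `M` with respect to `I`: the supremum of the lengths of
`M`-regular sequences contained in `I`. (Only meaningful if `I M ≠ M`.) -/
noncomputable def classicalDepth {R : Type u} [CommRing R] (I : Ideal R)
    (M : Type u) [AddCommGroup M] [Module R M] : ℕ∞ :=
  ⨆ (rs : List R) (_ : (∀ r ∈ rs, r ∈ I) ∧ IsRegular M rs), (rs.length : ℕ∞)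

/-- The *depth* of `M` with respect to `I`: the supremum over all faithfully flat extensions
`S` of `R` of the classical depth of `S ⊗ M` with respect to the extended ideal `I S`.
(Only meaningful if `I M ≠ M`.) -/
noncomputable def depthIdeal {R : Type u} [CommRing R] (I : Ideal R)
    (M : Type u) [AddCommGroup M] [Module R M] : ℕ∞ :=
  ⨆ (S : Type u) (_ : CommRing S) (_ : Algebra R S) (_ : Module.FaithfullyFlat R S),
    classicalDepth (I.map (algebraMap R S)) (S ⊗[R] M)

/-- The depth of a module over a quasi-local ring: its depth with respect to the maximal
ideal. -/
noncomputable def depth (R : Type u) [CommRing R] [IsLocalRing R]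
    (M : Type u) [AddCommGroup M] [Module R M] : ℕ∞ :=
  depthIdeal (IsLocalRing.maximalIdeal R) M

/-- The *G-class* of `R`: finitely generated modules `M` with `Extⁱ(M, R) = 0` and
`Extⁱ(M*, R) = 0` for all `i > 0` such that the natural map `M → M**` is an isomorphism. -/
structure IsGClass (R : Type u) [CommRing R] (M : Type u) [AddCommGroup M] [Module R M] :
    Prop where
  finite : Module.Finite R M
  ext_eq_zero : ∀ i : ℕ, 0 < i →
    Subsingleton (Abelian.Ext (ModuleCat.of R M) (ModuleCat.of R R) i)
  ext_dual_eq_zero : ∀ i : ℕ, 0 < i →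
    Subsingleton (Abelian.Ext (ModuleCat.of R (Module.Dual R M)) (ModuleCat.of R R) i)
  bijective_eval : Function.Bijective (Module.Dual.eval R M)

/-- A *G-resolution* of `M`: an exact sequence `⋯ → G₂ → G₁ → G₀ → M → 0` in which every
`Gₙ` belongs to the G-class of `R`. -/
structure GResolution (R : Type u) [CommRing R] (M : Type u) [AddCommGroup M] [Module R M] where
  /-- The terms of the resolution. -/
  G : ℕ → ModuleCat.{u} R
  /-- The differentials. -/
  d : ∀ n, G (n + 1) →ₗ[R] G n
  /-- The augmentation. -/
  aug : G 0 →ₗ[R] M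
  isGClass : ∀ n, IsGClass R (G n)
  exact_d : ∀ n, Function.Exact (d (n + 1)) (d n)
  exact_aug : Function.Exact (d 0) aug
  surjective_aug : Function.Surjective aug

/-- The length of a G-resolution: the supremum of the `n` with `Gₙ ≠ 0`
(`0` for the zero complex, `⊤` if infinitely many terms are nonzero). -/
noncomputable def GResolution.length {R : Type u} [CommRing R]
    {M : Type u} [AddCommGroup M] [Module R M] (P : GResolution R M) : ℕ∞ :=
  ⨆ (n : ℕ) (_ : Nontrivial (P.G n)), (n : ℕ∞)

/-- The *G-dimension* of `M`: the infimum of the lengths of all G-resolutions of `M`.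
It is `⊤` if `M` has no G-resolution of finite length (in particular if it has none at all),
so `M` has finite G-dimension if and only if `Gdim R M ≠ ⊤`. -/
noncomputable def Gdim (R : Type u) [CommRing R]
    (M : Type u) [AddCommGroup M] [Module R M] : ℕ∞ :=
  ⨅ P : GResolution R M, P.length

end Definitions

end GorensteinDim

/-! Faithfully flat extensions make depth behave like Noetherian grade. If a finitely generated
ideal `J` has no torsion on `M`, a polynomial whose coefficients generate `J` is regular on `M[X]`
(McCoy). Hence the existence of a weakly regular sequence of length `r` in some faithfully flat
extension is equivalent to `DepthGE`, a vanishing of Ext in degrees below `r` that is stable under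
further flat base change. In this form depth estimates pass along short exact sequences. Nakayama
makes weakly regular sequences regular.

The second ingredient is duality. For `G` finitely presented in the G-class and `T` flat, `T ⊗ G =
Hom(G*, T)`, and coherence gives `Extⁱ(G*, T) = 0` for `i > 0`. So a `T`-regular sequence `rs` is
weakly regular on `T ⊗ G`, with `(T ⊗ G)/rs = Hom(G*, T/rs)` (`hom_quot_ofList`). Thus `G` is at
least as deep as `R`, and climbing a free resolution whose `n`-th syzygy is in the G-class shows
that `r + n ≤ depth R` implies `r ≤ depth M`.

For the converse, suppose that `depth R` is exactly `r`, realised by `rs` in `T`. Then every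
finitely generated `J ≤ 𝔪` has torsion on `T/rs`, so every nonzero finitely presented module has a
nonzero map to `T/rs` (`exists_hom_ne_zero`). For `G ≠ 0` in the G-class, apply this to `G*/JG*`: it
yields nonzero `J`-torsion in `(T ⊗ G)/rs`, so `G` is not deeper than `R`. For `0 → K → F → M → 0`
with `F` free and `K` in the G-class, apply it to `Ext¹(M, R) = coker(F* → K*)`: a nonzero map gives
a nonzero element of the kernel of `(T ⊗ K)/rs → (T ⊗ F)/rs`, which is impossible if `rs` is also
regular on `T ⊗ M`. So if `M` is not in the G-class, `r ≤ depth M` forces `r + 1 ≤ depth R`. Larger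
G-dimension reduces to this case by passing to syzygies. -/

namespace GorensteinDim

/-- The group `Extⁱ(N, X)` vanishes. -/
abbrev ExtVanish (R : Type u) [CommRing R] (N X : Type u) [AddCommGroup N] [Module R N]
    [AddCommGroup X] [Module R X] (i : ℕ) : Prop :=
  Subsingleton (Abelian.Ext (ModuleCat.of R N) (ModuleCat.of R X) i)

/-! ### Vanishing of Ext along short exact sequences -/

section ExtVanish

variable {R : Type u} [CommRing R] {A B C X Y : Type u} [AddCommGroup A] [AddCommGroup B]
  [AddCommGroup C] [AddCommGroup X] [AddCommGroup Y] [Module R A] [Module R B] [Module R C]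
  [Module R X] [Module R Y] {f : A →ₗ[R] B} {g : B →ₗ[R] C}

/-- The short complex in `ModuleCat R` attached to an exact pair of linear maps. -/
abbrev shortComplexOfExact (f : A →ₗ[R] B) (g : B →ₗ[R] C) (h : Function.Exact f g) :
    ShortComplex (ModuleCat.{u} R) :=
  ModuleCat.shortComplexOfCompEqZero f g h.linearMap_comp_eq_zero

lemma shortExact_of_exact (hf : Function.Injective f) (hg : Function.Surjective g)
    (h : Function.Exact f g) : (shortComplexOfExact f g h).ShortExact where
  exact := ModuleCat.shortComplex_exact _ h
  mono_f := (ModuleCat.mono_iff_injective _).2 hf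
  epi_g := (ModuleCat.epi_iff_surjective _).2 hg

lemma ExtVanish.zero_iff : ExtVanish R X Y 0 ↔ ∀ φ : X →ₗ[R] Y, φ = 0 := by
  rw [ExtVanish, Abelian.Ext.homEquiv₀.subsingleton_congr,
    (ModuleCat.homEquiv (M := ModuleCat.of R X) (N := ModuleCat.of R Y)).subsingleton_congr]
  exact ⟨fun h φ => Subsingleton.elim _ _, fun h => ⟨fun a b => by rw [h a, h b]⟩⟩

lemma ExtVanish.middle_right (hf : Function.Injective f) (hg : Function.Surjective g)
    (h : Function.Exact f g) {i : ℕ} (hA : ExtVanish R X A i) (hC : ExtVanish R X C i) :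
    ExtVanish R X B i := by
  refine subsingleton_of_forall_eq 0 fun x => ?_
  obtain ⟨y, rfl⟩ := Abelian.Ext.covariant_sequence_exact₂ (ModuleCat.of R X)
    (shortExact_of_exact hf hg h) x (hC.elim _ _)
  rw [hA.elim y 0, Abelian.Ext.zero_comp]

lemma ExtVanish.right_right (hf : Function.Injective f) (hg : Function.Surjective g)
    (h : Function.Exact f g) {i : ℕ} (hB : ExtVanish R X B i) (hA : ExtVanish R X A (i + 1)) :
    ExtVanish R X C i := by
  refine subsingleton_of_forall_eq 0 fun x => ?_
  obtain ⟨y, rfl⟩ := Abelian.Ext.covariant_sequence_exact₃ (ModuleCat.of R X)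
    (shortExact_of_exact hf hg h) x rfl (hA.elim _ _)
  rw [hB.elim y 0, Abelian.Ext.zero_comp]

lemma ExtVanish.left_right (hf : Function.Injective f) (hg : Function.Surjective g)
    (h : Function.Exact f g) {i : ℕ} (hC : ExtVanish R X C i) (hB : ExtVanish R X B (i + 1)) :
    ExtVanish R X A (i + 1) := by
  refine subsingleton_of_forall_eq 0 fun x => ?_
  obtain ⟨y, rfl⟩ := Abelian.Ext.covariant_sequence_exact₁ (ModuleCat.of R X)
    (shortExact_of_exact hf hg h) x (hB.elim _ _) rfl
  rw [hC.elim y 0, Abelian.Ext.zero_comp]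

lemma ExtVanish.left_right_zero (hf : Function.Injective f) (hB : ExtVanish R X B 0) :
    ExtVanish R X A 0 := by
  rw [zero_iff] at hB ⊢
  exact fun φ => (LinearMap.cancel_left hf).1 (by rw [hB (f ∘ₗ φ), LinearMap.comp_zero])

lemma ExtVanish.middle_left (hf : Function.Injective f) (hg : Function.Surjective g)
    (h : Function.Exact f g) {i : ℕ} (hA : ExtVanish R A Y i) (hC : ExtVanish R C Y i) :
    ExtVanish R B Y i := by
  refine subsingleton_of_forall_eq 0 fun x => ?_
  obtain ⟨y, rfl⟩ := Abelian.Ext.contravariant_sequence_exact₂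
    (shortExact_of_exact hf hg h) (ModuleCat.of R Y) x (hA.elim _ _)
  rw [hC.elim y 0, Abelian.Ext.comp_zero]

lemma ExtVanish.left_left (hf : Function.Injective f) (hg : Function.Surjective g)
    (h : Function.Exact f g) {i : ℕ} (hB : ExtVanish R B Y i) (hC : ExtVanish R C Y (i + 1)) :
    ExtVanish R A Y i := by
  refine subsingleton_of_forall_eq 0 fun x => ?_
  obtain ⟨y, rfl⟩ := Abelian.Ext.contravariant_sequence_exact₁
    (shortExact_of_exact hf hg h) (ModuleCat.of R Y) x (add_comm 1 i) (hC.elim _ _)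
  rw [hB.elim y 0, Abelian.Ext.comp_zero]

lemma ExtVanish.right_left (hf : Function.Injective f) (hg : Function.Surjective g)
    (h : Function.Exact f g) {i : ℕ} (hA : ExtVanish R A Y i) (hB : ExtVanish R B Y (i + 1)) :
    ExtVanish R C Y (i + 1) := by
  refine subsingleton_of_forall_eq 0 fun x => ?_
  obtain ⟨y, rfl⟩ := Abelian.Ext.contravariant_sequence_exact₃
    (shortExact_of_exact hf hg h) (ModuleCat.of R Y) x (hB.elim _ _) (add_comm 1 i)
  rw [hA.elim y 0, Abelian.Ext.comp_zero]

lemma ExtVanish.exists_extension (hf : Function.Injective f) (hg : Function.Surjective g)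
    (h : Function.Exact f g) (hC : ExtVanish R C Y 1) (φ : A →ₗ[R] Y) :
    ∃ ψ : B →ₗ[R] Y, ψ ∘ₗ f = φ := by
  obtain ⟨y, hy⟩ := Abelian.Ext.contravariant_sequence_exact₁
    (shortExact_of_exact hf hg h) (ModuleCat.of R Y)
    (Abelian.Ext.mk₀ (ModuleCat.ofHom φ)) (add_zero 1) (hC.elim _ _)
  obtain ⟨ψ, rfl⟩ := Abelian.Ext.homEquiv₀.symm.surjective y
  refine ⟨ψ.hom, ?_⟩
  have h2 := (Abelian.Ext.mk₀_comp_mk₀ (shortComplexOfExact f g h).f ψ).symm.trans hy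
  exact congrArg ModuleCat.Hom.hom ((Abelian.Ext.mk₀_bijective _ _).1 h2)

lemma ExtVanish.one_of_extension (hf : Function.Injective f) (hg : Function.Surjective g)
    (h : Function.Exact f g) (hB : ExtVanish R B Y 1)
    (hφ : ∀ φ : A →ₗ[R] Y, ∃ ψ : B →ₗ[R] Y, ψ ∘ₗ f = φ) : ExtVanish R C Y 1 := by
  refine subsingleton_of_forall_eq 0 fun x => ?_
  obtain ⟨y, rfl⟩ := Abelian.Ext.contravariant_sequence_exact₃
    (shortExact_of_exact hf hg h) (ModuleCat.of R Y) x (hB.elim _ _) (add_zero 1)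
  obtain ⟨φ, rfl⟩ := Abelian.Ext.homEquiv₀.symm.surjective y
  obtain ⟨ψ, hψ⟩ := hφ φ.hom
  have h1 : φ = (shortComplexOfExact f g h).f ≫ ModuleCat.ofHom ψ := by
    ext a
    exact (LinearMap.congr_fun hψ a).symm
  rw [h1]
  change (shortExact_of_exact hf hg h).extClass.comp (Abelian.Ext.mk₀ _) _ = 0
  rw [← Abelian.Ext.mk₀_comp_mk₀]
  exact (shortExact_of_exact hf hg h).extClass_comp_assoc _

lemma ExtVanish.exists_lift (hf : Function.Injective f) (hg : Function.Surjective g)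
    (h : Function.Exact f g) (hA : ExtVanish R X A 1) (φ : X →ₗ[R] C) :
    ∃ ψ : X →ₗ[R] B, g ∘ₗ ψ = φ := by
  obtain ⟨y, hy⟩ := Abelian.Ext.covariant_sequence_exact₃ (ModuleCat.of R X)
    (shortExact_of_exact hf hg h)
    (Abelian.Ext.mk₀ (ModuleCat.ofHom φ)) (zero_add 1) (hA.elim _ _)
  obtain ⟨ψ, rfl⟩ := Abelian.Ext.homEquiv₀.symm.surjective y
  refine ⟨ψ.hom, ?_⟩
  have h2 := (Abelian.Ext.mk₀_comp_mk₀ ψ (shortComplexOfExact f g h).g).symm.trans hy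
  exact congrArg ModuleCat.Hom.hom ((Abelian.Ext.mk₀_bijective _ _).1 h2)

lemma ExtVanish.congr_right (e : X ≃ₗ[R] Y) {i : ℕ} (h : ExtVanish R A X i) :
    ExtVanish R A Y i := by
  refine subsingleton_of_forall_eq 0 fun x => ?_
  have : x = (x.comp (Abelian.Ext.mk₀ e.symm.toModuleIso.hom) (add_zero i)).comp
      (Abelian.Ext.mk₀ e.symm.toModuleIso.inv) (add_zero i) := by
    rw [Abelian.Ext.comp_assoc_of_second_deg_zero, Abelian.Ext.mk₀_comp_mk₀, Iso.hom_inv_id,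
      Abelian.Ext.comp_mk₀_id]
  rw [this, h.elim (x.comp _ _) 0, Abelian.Ext.zero_comp]

lemma ExtVanish.congr_left (e : X ≃ₗ[R] Y) {i : ℕ} (h : ExtVanish R X A i) :
    ExtVanish R Y A i := by
  refine subsingleton_of_forall_eq 0 fun x => ?_
  have : x = (Abelian.Ext.mk₀ e.toModuleIso.inv).comp
      ((Abelian.Ext.mk₀ e.toModuleIso.hom).comp x (zero_add i)) (zero_add i) := by
    rw [Abelian.Ext.mk₀_comp_mk₀_assoc, Iso.inv_hom_id, Abelian.Ext.mk₀_id_comp]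
  rw [this, h.elim (Abelian.Ext.comp _ x _) 0, Abelian.Ext.comp_zero]

lemma ExtVanish.of_projective [Module.Projective R X] {i : ℕ} (hi : 0 < i) :
    ExtVanish R X Y i := by
  obtain ⟨n, rfl⟩ := Nat.exists_eq_succ_of_ne_zero hi.ne'
  have : Projective (ModuleCat.of R X) := (IsProjective.iff_projective _).1 inferInstance
  exact Abelian.Ext.subsingleton_of_projective _ _ n

/-- Multiplication by `y` on `Ext(X, Y)` may be computed on either argument. On `X` it is zero, so
every class comes from `Extⁱ(X, Y/yY)` through the connecting map. -/
lemma ExtVanish.succ_of_smul_eq_zero {y : R} (hX : ∀ x : X, y • x = 0) (hy : IsSMulRegular Y y)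
    {i : ℕ} (h : ExtVanish R X (QuotSMulTop y Y) i) : ExtVanish R X Y (i + 1) := by
  refine subsingleton_of_forall_eq 0 fun x => ?_
  have h0 : y • 𝟙 (ModuleCat.of R X) = 0 := by
    ext z
    exact hX z
  have hS := shortExact_of_exact (f := LinearMap.lsmul R Y y) hy (Submodule.mkQ_surjective _)
    (LinearMap.exact_lsmul_mkQ_smul_top Y y)
  have hx : x.comp (Abelian.Ext.mk₀ (y • 𝟙 (ModuleCat.of R Y))) (add_zero _) = 0 := by
    rw [Abelian.Ext.mk₀_smul, Abelian.Ext.comp_smul, Abelian.Ext.comp_mk₀_id,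
      ← Abelian.Ext.mk₀_id_comp x, ← Abelian.Ext.smul_comp, ← Abelian.Ext.mk₀_smul, h0,
      Abelian.Ext.mk₀_zero, Abelian.Ext.zero_comp]
  obtain ⟨z, rfl⟩ := Abelian.Ext.covariant_sequence_exact₁ (ModuleCat.of R X) hS x hx rfl
  rw [h.elim z 0, Abelian.Ext.zero_comp]

end ExtVanish

/-! ### Homological grade -/

/-- `Extⁱ(N, M) = 0` for all `i < r` and all modules `N` killed by `J`. -/
def GradeGE {R : Type u} [CommRing R] (J : Ideal R) (r : ℕ) (M : Type u) [AddCommGroup M]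
    [Module R M] : Prop :=
  ∀ (N : Type u) [AddCommGroup N] [Module R N], (∀ a ∈ J, ∀ x : N, a • x = 0) →
    ∀ i < r, ExtVanish R N M i

namespace GradeGE

variable {R : Type u} [CommRing R] {J J' : Ideal R} {A B C M : Type u} [AddCommGroup A]
  [AddCommGroup B] [AddCommGroup C] [AddCommGroup M] [Module R A] [Module R B] [Module R C]
  [Module R M] {f : A →ₗ[R] B} {g : B →ₗ[R] C} {r s : ℕ}

lemma mono (h : GradeGE J r M) (hJ : J ≤ J') (hs : s ≤ r) : GradeGE J' s M :=
  fun N _ _ hN i hi => h N (fun a ha => hN a (hJ ha)) i (hi.trans_le hs)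

lemma congr (e : A ≃ₗ[R] B) (h : GradeGE J r A) : GradeGE J r B :=
  fun N _ _ hN i hi => (h N hN i hi).congr_right e

lemma middle (hf : Function.Injective f) (hg : Function.Surjective g) (h : Function.Exact f g)
    (hA : GradeGE J r A) (hC : GradeGE J r C) : GradeGE J r B :=
  fun N _ _ hN i hi => (hA N hN i hi).middle_right hf hg h (hC N hN i hi)

lemma right (hf : Function.Injective f) (hg : Function.Surjective g) (h : Function.Exact f g)
    (hA : GradeGE J (r + 1) A) (hB : GradeGE J r B) : GradeGE J r C :=
  fun N _ _ hN i hi => (hB N hN i hi).right_right hf hg h (hA N hN (i + 1) (by lia))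

lemma left (hf : Function.Injective f) (hg : Function.Surjective g) (h : Function.Exact f g)
    (hB : GradeGE J (r + 1) B) (hC : GradeGE J r C) : GradeGE J (r + 1) A := by
  intro N _ _ hN i hi
  cases i with
  | zero => exact (hB N hN 0 hi).left_right_zero hf
  | succ i => exact (hC N hN i (by lia)).left_right hf hg h (hB N hN (i + 1) hi)

lemma quotSMulTop (h : GradeGE J (r + 1) M) {y : R} (hy : IsSMulRegular M y) :
    GradeGE J r (QuotSMulTop y M) :=
  right (f := LinearMap.lsmul R M y) hy (Submodule.mkQ_surjective _)
    (LinearMap.exact_lsmul_mkQ_smul_top M y) h (h.mono le_rfl r.le_succ)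

lemma quot_ofList {rs : List R} (hrs : IsWeaklyRegular M rs) (h : GradeGE J (r + rs.length) M) :
    GradeGE J r (M ⧸ (Ideal.ofList rs • ⊤ : Submodule R M)) := by
  induction rs generalizing M with
  | nil =>
    refine h.congr (Submodule.quotEquivOfEqBot _ ?_).symm
    rw [Ideal.ofList_nil, Submodule.bot_smul]
  | cons y rs ih =>
    rw [isWeaklyRegular_cons_iff] at hrs
    refine (ih hrs.2 (quotSMulTop ?_ hrs.1)).congr
      (Submodule.quotOfListConsSMulTopEquivQuotSMulTopInner M y rs).symm
    exact h

lemma of_isWeaklyRegular {rs : List R} (hrs : IsWeaklyRegular M rs) (hJ : ∀ y ∈ rs, y ∈ J) :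
    GradeGE J rs.length M := by
  induction rs generalizing M with
  | nil => exact fun N _ _ _ i hi => absurd hi (Nat.not_lt_zero i)
  | cons y rs ih =>
    rw [isWeaklyRegular_cons_iff] at hrs
    have hq := ih hrs.2 fun z hz => hJ z (List.mem_cons_of_mem _ hz)
    intro N _ _ hN i hi
    have hyN := hN y (hJ y List.mem_cons_self)
    cases i with
    | zero =>
      rw [ExtVanish.zero_iff]
      intro φ
      ext x
      refine hrs.1.right_eq_zero_of_smul ?_
      rw [← map_smul, hyN, map_zero]
    | succ i => exact .succ_of_smul_eq_zero hyN hrs.1 (hq N hN i (by simpa using hi))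

lemma eq_zero_of_forall_smul (h : GradeGE J (r + 1) M) {m : M} (hm : ∀ a ∈ J, a • m = 0) :
    m = 0 := by
  have h0 := h (R ⧸ J) (fun a ha x => by
    obtain ⟨x, rfl⟩ := Submodule.Quotient.mk_surjective _ x
    rw [← Submodule.Quotient.mk_smul, Submodule.Quotient.mk_eq_zero]
    exact J.mul_mem_right x ha) 0 r.succ_pos
  rw [ExtVanish.zero_iff] at h0
  have h1 := LinearMap.congr_fun (h0 (Submodule.liftQ J (LinearMap.toSpanSingleton R M m) hm))
    (Submodule.Quotient.mk 1)
  exact (one_smul R m).symm.trans h1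

end GradeGE

/-! ### McCoy's theorem and regular elements after adjoining a variable -/

section Polynomial

open Polynomial

variable {R M : Type*} [CommRing R] [AddCommGroup M] [Module R M]

/-- A module version of McCoy's theorem. -/
lemma isSMulRegular_polynomialModule (f : R[X])
    (hf : ∀ m : M, (∀ i, f.coeff i • m = 0) → m = 0) : IsSMulRegular (PolynomialModule R M) f := by
  -- Induction on a strict bound `d` for the degree of `u`.
  have key : ∀ (d : ℕ) (u : PolynomialModule R M), (∀ n, d ≤ n → u.coeff n = 0) → f • u = 0 →
      u = 0 := by
    intro d
    induction d with
    | zero =>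
      intro u hu _
      refine PolynomialModule.coeff_injective (Finsupp.ext fun n => ?_)
      exact hu n n.zero_le
    | succ d ih =>
      intro u hu hfu
      -- Descending induction on `i`, counted by `j`: once all higher coefficients of `f` kill `u`,
      -- the multiple of `u` by the `i`-th one has smaller degree and is still killed by `f`.
      have hz : ∀ j i, f.natDegree < i + j → f.coeff i • u = 0 := by
        intro j
        induction j with
        | zero =>
          intro i hi
          rw [Polynomial.coeff_eq_zero_of_natDegree_lt (by simpa using hi), zero_smul]
        | succ j ihj =>
          intro i hi
          refine ih _ (fun n hn => ?_) ?_
          · change f.coeff i • u.coeff n = 0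
            rcases hn.eq_or_lt with rfl | hn
            · have h1 := congrArg (fun v => PolynomialModule.coeff v (i + d)) hfu
              simp only [PolynomialModule.smul_apply] at h1
              rw [Finset.sum_eq_single (i, d)] at h1
              · exact h1
              · rintro ⟨x, y⟩ hxy hne
                rw [Finset.HasAntidiagonal.mem_antidiagonal] at hxy
                rcases Nat.lt_or_ge d y with hy | hy
                · simp only [hu y hy, smul_zero]
                · have hx : i < x := by
                    rcases hy.eq_or_lt with rfl | hy
                    · exact absurd (by simpa using hxy) (fun h : x = i => hne (by rw [h]))
                    · simp only at hxy
                      lia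
                  exact congrArg (fun v => PolynomialModule.coeff v y) (ihj x (by lia))
              · intro h
                exact (h (Finset.HasAntidiagonal.mem_antidiagonal.2 rfl)).elim
            · rw [hu n hn, smul_zero]
          · rw [smul_algebra_smul_comm, hfu, smul_zero]
      refine PolynomialModule.coeff_injective (Finsupp.ext fun n => hf _ fun i => ?_)
      exact congrArg (fun v => PolynomialModule.coeff v n) (hz (f.natDegree + 1) i (by lia))
  refine IsSMulRegular.of_right_eq_zero_of_smul fun u hu => ?_
  obtain ⟨d, hd⟩ := u.coeff.support.bddAbove
  refine key (d + 1) u (fun n hn => ?_) hu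
  by_contra h
  exact absurd (hd (Finsupp.mem_support_iff.2 h)) (by lia)

lemma isSMulRegular_polynomial_tensor (f : R[X])
    (hf : ∀ m : M, (∀ i, f.coeff i • m = 0) → m = 0) : IsSMulRegular (R[X] ⊗[R] M) f :=
  ((PolynomialModule.polynomialTensorProductLEquivPolynomialModule R M).isSMulRegular_congr f).2
    (isSMulRegular_polynomialModule f hf)

/-- A finitely generated ideal with no torsion on `M` contains, after adjoining a variable, an
element which is regular on the base change of `M`. -/
lemma exists_polynomial_isSMulRegular {J : Ideal R} (hJ : J.FG)
    (h : ∀ m : M, (∀ a ∈ J, a • m = 0) → m = 0) :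
    ∃ f ∈ J.map (algebraMap R R[X]), IsSMulRegular (R[X] ⊗[R] M) f := by
  obtain ⟨n, x, rfl⟩ := Submodule.fg_iff_exists_fin_generating_family.1 hJ
  have hcoeff : ∀ i : Fin n, (∑ j : Fin n, monomial (j : ℕ) (x j)).coeff i = x i := by
    intro i
    rw [finsetSum_coeff, Finset.sum_eq_single i]
    · simp
    · intro j _ hj
      rw [coeff_monomial, if_neg fun h => hj (Fin.ext h)]
    · simp
  refine ⟨∑ j : Fin n, monomial (j : ℕ) (x j), ?_, ?_⟩
  · refine Ideal.sum_mem _ fun j _ => ?_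
    rw [← C_mul_X_pow_eq_monomial]
    exact Ideal.mul_mem_right _ _ (Ideal.mem_map_of_mem _ (Submodule.subset_span ⟨j, rfl⟩))
  · refine isSMulRegular_polynomial_tensor _ fun m hm => h m fun a ha => ?_
    induction ha using Submodule.span_induction with
    | mem a ha =>
      obtain ⟨i, rfl⟩ := ha
      rw [← hcoeff i]
      exact hm i
    | zero => exact zero_smul R m
    | add a b _ _ ha hb => rw [add_smul, ha, hb, add_zero]
    | smul c a _ ha => rw [smul_assoc, ha, smul_zero]

end Polynomial

/-! ### Depth as stable grade -/

open Polynomial in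
/-- If all flat base changes of `X` have grade at least `r`, then some faithfully flat base change
admits a weakly regular sequence of length `r`. -/
lemma exists_isWeaklyRegular_of_gradeGE (r : ℕ) :
    ∀ (S : Type u) [CommRing S] (X : Type u) [AddCommGroup X] [Module S X] (J : Ideal S),
      J.FG → (∀ (T : Type u) [CommRing T] [Algebra S T] [Module.Flat S T],
        GradeGE (J.map (algebraMap S T)) r (T ⊗[S] X)) →
      ∃ (T : Type u) (_ : CommRing T) (_ : Algebra S T) (_ : Module.FaithfullyFlat S T)
        (rs : List T), rs.length = r ∧ (∀ y ∈ rs, y ∈ J.map (algebraMap S T)) ∧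
          IsWeaklyRegular (T ⊗[S] X) rs := by
  induction r with
  | zero =>
    intro S _ X _ _ J _ _
    exact ⟨S, _, _, inferInstance, [], rfl, by simp, .nil _ _⟩
  | succ r ih =>
    intro S _ X _ _ J hJ h
    obtain ⟨f, hfJ, hf⟩ := exists_polynomial_isSMulRegular (M := X) hJ fun m hm => by
      have h1 := (h S).congr (TensorProduct.lid S X)
      rw [Algebra.algebraMap_self, Ideal.map_id] at h1
      exact h1.eq_zero_of_forall_smul hm
    -- Killing `f` costs one unit of grade, after every flat base change of `S[X]`; this is the
    -- hypothesis of the induction over the new base.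
    have hT : ∀ (T : Type u) [CommRing T] [Algebra S[X] T] [Module.Flat S[X] T],
        GradeGE ((J.map (algebraMap S S[X])).map (algebraMap S[X] T)) r
          (T ⊗[S[X]] QuotSMulTop f (S[X] ⊗[S] X)) := by
      intro T _ _ _
      algebraize [(algebraMap S[X] T).comp (algebraMap S S[X])]
      have : Module.Flat S T := .trans S S[X] T
      have h1 := (h T).congr (TensorProduct.AlgebraTensorModule.cancelBaseChange S S[X] T T X).symm
      rw [IsScalarTower.algebraMap_eq S S[X] T, ← Ideal.map_map] at h1
      refine (h1.quotSMulTop (y := algebraMap S[X] T f) ?_).congr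
        (QuotSMulTop.algebraMapTensorEquivTensorQuotSMulTop f _ T)
      exact hf.of_flat_of_isBaseChange (TensorProduct.isBaseChange S[X] (S[X] ⊗[S] X) T)
    obtain ⟨T, _, _, _, rs, hrs, hJrs, hreg⟩ := ih S[X] _ _ (hJ.map _) hT
    algebraize [(algebraMap S[X] T).comp (algebraMap S S[X])]
    have : Module.FaithfullyFlat S S[X] := .of_linearEquiv _ _ (basisMonomials S).repr
    have : Module.FaithfullyFlat S T := .trans S S[X] T
    rw [Ideal.map_map, ← IsScalarTower.algebraMap_eq] at hJrs
    refine ⟨T, _, _, this, algebraMap S[X] T f :: rs, by simp [hrs], ?_, ?_⟩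
    · intro y hy
      rcases List.mem_cons.1 hy with rfl | hy
      · rw [IsScalarTower.algebraMap_eq S S[X] T, ← Ideal.map_map]
        exact Ideal.mem_map_of_mem _ hfJ
      · exact hJrs y hy
    · rw [← (TensorProduct.AlgebraTensorModule.cancelBaseChange S S[X] T T X).isWeaklyRegular_congr,
        isWeaklyRegular_cons_iff]
      refine ⟨hf.of_flat_of_isBaseChange (TensorProduct.isBaseChange S[X] (S[X] ⊗[S] X) T), ?_⟩
      rwa [(QuotSMulTop.algebraMapTensorEquivTensorQuotSMulTop f _ T).isWeaklyRegular_congr]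

/-- The maximal ideal need not be finitely generated, but McCoy's polynomial needs finitely many
generators. An element of an extended ideal involves only finitely many elements of `I`. -/
lemma exists_fg_le_of_mem_map {R S : Type*} [CommRing R] [CommRing S] (φ : R →+* S) {I : Ideal R}
    {y : S} (hy : y ∈ I.map φ) : ∃ J : Ideal R, J.FG ∧ J ≤ I ∧ y ∈ J.map φ := by
  induction hy using Submodule.span_induction with
  | mem y hy =>
    obtain ⟨a, ha, rfl⟩ := hy
    exact ⟨Ideal.span {a}, ⟨{a}, by simp⟩, (Ideal.span_singleton_le_iff_mem _).2 ha,
      Ideal.mem_map_of_mem φ (Ideal.mem_span_singleton_self a)⟩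
  | zero => exact ⟨⊥, Submodule.fg_bot, bot_le, zero_mem _⟩
  | add y z _ _ hy hz =>
    obtain ⟨J, hJ, hJI, h⟩ := hy
    obtain ⟨J', hJ', hJI', h'⟩ := hz
    exact ⟨J ⊔ J', Submodule.FG.sup hJ hJ', sup_le hJI hJI',
      add_mem (Ideal.map_mono le_sup_left h) (Ideal.map_mono le_sup_right h')⟩
  | smul s y _ hy =>
    obtain ⟨J, hJ, hJI, h⟩ := hy
    exact ⟨J, hJ, hJI, Ideal.mul_mem_left _ s h⟩

lemma exists_fg_le_of_forall_mem_map {R S : Type*} [CommRing R] [CommRing S] (φ : R →+* S)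
    {I : Ideal R} (rs : List S) (h : ∀ y ∈ rs, y ∈ I.map φ) :
    ∃ J : Ideal R, J.FG ∧ J ≤ I ∧ ∀ y ∈ rs, y ∈ J.map φ := by
  induction rs with
  | nil => exact ⟨⊥, Submodule.fg_bot, bot_le, by simp⟩
  | cons y rs ih =>
    obtain ⟨J, hJ, hJI, h1⟩ := exists_fg_le_of_mem_map φ (h y List.mem_cons_self)
    obtain ⟨J', hJ', hJI', h2⟩ := ih fun z hz => h z (List.mem_cons_of_mem _ hz)
    refine ⟨J ⊔ J', Submodule.FG.sup hJ hJ', sup_le hJI hJI', fun z hz => ?_⟩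
    rcases List.mem_cons.1 hz with rfl | hz
    · exact Ideal.map_mono le_sup_left h1
    · exact Ideal.map_mono le_sup_right (h2 z hz)

/-- After some faithfully flat base change `R → S`, all further flat base changes of `M` have
grade at least `r` with respect to a fixed finitely generated ideal contained in `I`. -/
def DepthGE {R : Type u} [CommRing R] (I : Ideal R) (r : ℕ) (M : Type u) [AddCommGroup M]
    [Module R M] : Prop :=
  ∃ (S : Type u) (_ : CommRing S) (_ : Algebra R S) (_ : Module.FaithfullyFlat R S)
    (J : Ideal R), J.FG ∧ J ≤ I ∧ ∀ (T : Type u) [CommRing T] [Algebra R T] [Algebra S T]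
      [IsScalarTower R S T] [Module.Flat S T], GradeGE (J.map (algebraMap R T)) r (T ⊗[R] M)

namespace DepthGE

variable {R : Type u} [CommRing R] {I : Ideal R} {A B C M : Type u} [AddCommGroup A]
  [AddCommGroup B] [AddCommGroup C] [AddCommGroup M] [Module R A] [Module R B] [Module R C]
  [Module R M] {f : A →ₗ[R] B} {g : B →ₗ[R] C} {r s : ℕ}

lemma of_isWeaklyRegular {S : Type u} [CommRing S] [Algebra R S] [Module.FaithfullyFlat R S]
    {rs : List S} (hI : ∀ y ∈ rs, y ∈ I.map (algebraMap R S))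
    (hrs : IsWeaklyRegular (S ⊗[R] M) rs) : DepthGE I rs.length M := by
  obtain ⟨J, hJ, hJI, hrsJ⟩ := exists_fg_le_of_forall_mem_map _ rs hI
  refine ⟨S, _, _, inferInstance, J, hJ, hJI, fun T _ _ _ _ _ => ?_⟩
  have h1 := hrs.of_flat_of_isBaseChange (TensorProduct.isBaseChange S (S ⊗[R] M) T)
  rw [(TensorProduct.AlgebraTensorModule.cancelBaseChange R S T T M).isWeaklyRegular_congr] at h1
  have h2 := GradeGE.of_isWeaklyRegular (J := J.map (algebraMap R T)) h1 fun y hy => by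
    obtain ⟨z, hz, rfl⟩ := List.mem_map.1 hy
    rw [IsScalarTower.algebraMap_eq R S T, ← Ideal.map_map]
    exact Ideal.mem_map_of_mem _ (hrsJ z hz)
  rwa [List.length_map] at h2

lemma exists_isWeaklyRegular (h : DepthGE I r M) :
    ∃ (S : Type u) (_ : CommRing S) (_ : Algebra R S) (_ : Module.FaithfullyFlat R S)
      (rs : List S), rs.length = r ∧ (∀ y ∈ rs, y ∈ I.map (algebraMap R S)) ∧
        IsWeaklyRegular (S ⊗[R] M) rs := by
  obtain ⟨S, _, _, _, J, hJ, hJI, h⟩ := h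
  obtain ⟨T, _, _, _, rs, hrs, hrsJ, hreg⟩ := exists_isWeaklyRegular_of_gradeGE r S (S ⊗[R] M)
    (J.map (algebraMap R S)) (hJ.map _) fun T _ _ _ => by
      algebraize [(algebraMap S T).comp (algebraMap R S)]
      rw [Ideal.map_map, ← IsScalarTower.algebraMap_eq]
      exact (h T).congr (TensorProduct.AlgebraTensorModule.cancelBaseChange R S T T M).symm
  algebraize [(algebraMap S T).comp (algebraMap R S)]
  rw [Ideal.map_map, ← IsScalarTower.algebraMap_eq] at hrsJ
  have : Module.FaithfullyFlat R T := .trans R S T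
  exact ⟨T, _, _, this, rs, hrs, fun y hy => Ideal.map_mono hJI (hrsJ y hy),
    ((TensorProduct.AlgebraTensorModule.cancelBaseChange R S T T M).isWeaklyRegular_congr _).1
      hreg⟩

variable (I M) in
lemma zero : DepthGE I 0 M :=
  ⟨R, _, _, inferInstance, ⊥, Submodule.fg_bot, bot_le, fun _ _ _ _ _ _ _ _ _ _ i hi =>
    absurd hi (Nat.not_lt_zero i)⟩

lemma mono (h : DepthGE I r M) (hs : s ≤ r) : DepthGE I s M := by
  obtain ⟨S, _, _, _, J, hJ, hJI, h⟩ := h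
  exact ⟨S, _, _, inferInstance, J, hJ, hJI, fun T _ _ _ _ _ => (h T).mono le_rfl hs⟩

/-- The witnesses `S` and `S'` are both dominated by `S ⊗ S'`. Stability under all flat extensions
in `DepthGE` is what allows this common choice. -/
lemma combine (hA : DepthGE I r A) (hB : DepthGE I s B) :
    ∃ (S : Type u) (_ : CommRing S) (_ : Algebra R S) (_ : Module.FaithfullyFlat R S)
    (J : Ideal R), J.FG ∧ J ≤ I ∧ ∀ (T : Type u) [CommRing T] [Algebra R T] [Algebra S T]
      [IsScalarTower R S T] [Module.Flat S T], GradeGE (J.map (algebraMap R T)) r (T ⊗[R] A) ∧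
        GradeGE (J.map (algebraMap R T)) s (T ⊗[R] B) := by
  obtain ⟨S, _, _, _, J, hJ, hJI, h⟩ := hA
  obtain ⟨S', _, _, _, J', hJ', hJI', h'⟩ := hB
  have : Module.FaithfullyFlat R (S ⊗[R] S') := .trans R S _
  refine ⟨S ⊗[R] S', _, _, this, J ⊔ J', Submodule.FG.sup hJ hJ', sup_le hJI hJI',
    fun T _ _ _ _ _ => ⟨?_, ?_⟩⟩
  · algebraize [(algebraMap (S ⊗[R] S') T).comp (algebraMap S (S ⊗[R] S'))]
    have : IsScalarTower R S T := .of_algebraMap_eq' <| by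
      rw [IsScalarTower.algebraMap_eq R (S ⊗[R] S') T,
        IsScalarTower.algebraMap_eq R S (S ⊗[R] S'), ← RingHom.comp_assoc]
      rfl
    have : Module.Flat S T := .trans S (S ⊗[R] S') T
    exact (h T).mono (Ideal.map_mono le_sup_left) le_rfl
  · let _ : Algebra S' (S ⊗[R] S') := Algebra.TensorProduct.rightAlgebra
    algebraize [(algebraMap (S ⊗[R] S') T).comp (algebraMap S' (S ⊗[R] S'))]
    have : IsScalarTower R S' T := .of_algebraMap_eq' <| by
      rw [IsScalarTower.algebraMap_eq R (S ⊗[R] S') T,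
        IsScalarTower.algebraMap_eq R S' (S ⊗[R] S'), ← RingHom.comp_assoc]
      rfl
    have : Module.Flat S' (S ⊗[R] S') :=
      .of_linearEquiv
        (Algebra.TensorProduct.commRight R S' S).toLinearEquiv.symm
    have : Module.Flat S' T := .trans S' (S ⊗[R] S') T
    exact (h' T).mono (Ideal.map_mono le_sup_right) le_rfl

section ShortExact

variable (hf : Function.Injective f) (hg : Function.Surjective g) (h : Function.Exact f g)
include hf hg h

lemma middle (hA : DepthGE I r A) (hC : DepthGE I r C) : DepthGE I r B := by
  obtain ⟨S, _, _, _, J, hJ, hJI, hT⟩ := hA.combine hC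
  refine ⟨S, _, _, inferInstance, J, hJ, hJI, fun T _ _ _ _ _ => ?_⟩
  have : Module.Flat R T := .trans R S T
  exact (hT T).1.middle (f := f.baseChange T) (g := g.baseChange T)
    (Module.Flat.lTensor_preserves_injective_linearMap f hf) (LinearMap.lTensor_surjective T hg)
    (lTensor_exact T h hg) (hT T).2

lemma right (hA : DepthGE I (r + 1) A) (hB : DepthGE I r B) : DepthGE I r C := by
  obtain ⟨S, _, _, _, J, hJ, hJI, hT⟩ := hA.combine hB
  refine ⟨S, _, _, inferInstance, J, hJ, hJI, fun T _ _ _ _ _ => ?_⟩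
  have : Module.Flat R T := .trans R S T
  exact .right (f := f.baseChange T) (g := g.baseChange T)
    (Module.Flat.lTensor_preserves_injective_linearMap f hf) (LinearMap.lTensor_surjective T hg)
    (lTensor_exact T h hg) (hT T).1 (hT T).2

lemma left (hB : DepthGE I (r + 1) B) (hC : DepthGE I r C) : DepthGE I (r + 1) A := by
  obtain ⟨S, _, _, _, J, hJ, hJI, hT⟩ := hB.combine hC
  refine ⟨S, _, _, inferInstance, J, hJ, hJI, fun T _ _ _ _ _ => ?_⟩
  have : Module.Flat R T := .trans R S T
  exact .left (f := f.baseChange T) (g := g.baseChange T)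
    (Module.Flat.lTensor_preserves_injective_linearMap f hf) (LinearMap.lTensor_surjective T hg)
    (lTensor_exact T h hg) (hT T).1 (hT T).2

end ShortExact

lemma prod (hA : DepthGE I r A) (hB : DepthGE I r B) : DepthGE I r (A × B) :=
  middle LinearMap.inl_injective LinearMap.snd_surjective .inl_snd hA hB

end DepthGE

/-! ### Comparison with depth over a local ring -/

section Local

variable {R : Type u} [CommRing R] [IsLocalRing R] {M : Type u} [AddCommGroup M] [Module R M]

lemma isRegular_of_isWeaklyRegular [Nontrivial M] [Module.Finite R M] {S : Type u} [CommRing S]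
    [Algebra R S] [Module.FaithfullyFlat R S] {rs : List S}
    (hrs : ∀ y ∈ rs, y ∈ (IsLocalRing.maximalIdeal R).map (algebraMap R S))
    (h : IsWeaklyRegular (S ⊗[R] M) rs) : IsRegular (S ⊗[R] M) rs := by
  refine ⟨h, fun htop => ?_⟩
  -- Nakayama; faithful flatness carries the inequality to `S`.
  have h1 : IsLocalRing.maximalIdeal R • (⊤ : Submodule R M) ≠ ⊤ := fun h2 =>
    Submodule.top_ne_ideal_smul_of_le_jacobson_annihilator
      (IsLocalRing.maximalIdeal_le_jacobson _) h2.symm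
  have h2 : (IsLocalRing.maximalIdeal R).map (algebraMap R S) •
      (⊤ : Submodule S (S ⊗[R] M)) ≠ ⊤ :=
    ((TensorProduct.isBaseChange R M S).map_smul_top_ne_top_iff_of_faithfullyFlat R M _).2 h1
  have h3 : Ideal.ofList rs • (⊤ : Submodule S (S ⊗[R] M)) ≤
      (IsLocalRing.maximalIdeal R).map (algebraMap R S) • ⊤ :=
    Submodule.smul_mono_left (Ideal.span_le.2 hrs)
  rw [← htop] at h3
  exact h2 (top_le_iff.1 h3)

lemma natCast_le_depth_iff [Nontrivial M] [Module.Finite R M] (r : ℕ) :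
    (r : ℕ∞) ≤ depth R M ↔ DepthGE (IsLocalRing.maximalIdeal R) r M := by
  constructor
  · intro h
    cases r with
    | zero => exact .zero _ _
    | succ r =>
      -- A strict bound below a supremum is exceeded by some member, so an actual sequence of length
      -- at least `r + 1` exists.
      have h1 : (r : ℕ∞) < depth R M := lt_of_lt_of_le (by exact_mod_cast r.lt_succ_self) h
      simp only [depth, depthIdeal, classicalDepth, lt_iSup_iff] at h1
      obtain ⟨S, _, _, _, rs, ⟨hrs, hreg⟩, hlt⟩ := h1
      exact (DepthGE.of_isWeaklyRegular hrs hreg.1).mono (by exact_mod_cast hlt)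
  · intro h
    obtain ⟨S, _, _, _, rs, rfl, hrs, hreg⟩ := h.exists_isWeaklyRegular
    refine le_trans ?_ (le_iSup_of_le S <| le_iSup_of_le _ <| le_iSup_of_le _ <|
      le_iSup_of_le inferInstance <| le_iSup_of_le rs <|
        le_iSup_of_le ⟨hrs, isRegular_of_isWeaklyRegular hrs hreg⟩ le_rfl)
    exact le_rfl

lemma add_eq_of_forall_natCast_le_iff {a b : ℕ∞} (n : ℕ)
    (h : ∀ r : ℕ, (r : ℕ∞) ≤ a ↔ ((r + n : ℕ) : ℕ∞) ≤ b) : a + n = b := by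
  refine ENat.eq_of_forall_natCast_le_iff fun m => ?_
  rcases le_total n m with hnm | hnm
  · obtain ⟨r, rfl⟩ := Nat.exists_eq_add_of_le' hnm
    rw [← h, Nat.cast_add]
    exact WithTop.add_le_add_iff_right (ENat.natCast_ne_top n)
  · have h0 : ((0 + n : ℕ) : ℕ∞) ≤ b := (h 0).1 (by simp)
    rw [zero_add] at h0
    have hnm' : (m : ℕ∞) ≤ n := by exact_mod_cast hnm
    exact iff_of_true (hnm'.trans le_add_self) (hnm'.trans h0)

end Local

/-! ### Finite presentation over coherent rings -/

section Coherent

variable {R : Type u} [CommRing R]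

/-- Project to the first coordinate: the image is a finitely generated ideal, hence finitely
presented, and the kernel is finitely generated and lies in a free module of smaller rank. -/
lemma IsCoherentRing.finitePresentation_of_injective (hR : IsCoherentRing R) (k : ℕ) :
    ∀ {N : Type u} [AddCommGroup N] [Module R N] [Module.Finite R N] (f : N →ₗ[R] (Fin k → R)),
      Function.Injective f → Module.FinitePresentation R N := by
  induction k with
  | zero =>
    intro N _ _ _ f hf
    have := hf.subsingleton
    infer_instance
  | succ k ih =>
    intro N _ _ _ f hf
    let p : N →ₗ[R] R := LinearMap.proj 0 ∘ₗ f
    have : Module.FinitePresentation R (LinearMap.range p) := hR _ (Submodule.fg_range p)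
    have : Module.Finite R (LinearMap.ker p.rangeRestrict) :=
      Module.Finite.of_fg (Module.FinitePresentation.fg_ker _ p.surjective_rangeRestrict)
    have : Module.FinitePresentation R (LinearMap.ker p.rangeRestrict) := by
      refine ih (LinearMap.funLeft R R Fin.succ ∘ₗ f ∘ₗ Submodule.subtype _) fun x y hxy => ?_
      refine Subtype.ext (hf (funext fun i => ?_))
      refine Fin.cases ?_ (fun j => congrFun hxy j) i
      have hx : p x = 0 := congrArg Subtype.val (LinearMap.mem_ker.1 x.2)
      have hy : p y = 0 := congrArg Subtype.val (LinearMap.mem_ker.1 y.2)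
      exact hx.trans hy.symm
    exact Module.finitePresentation_of_ker p.rangeRestrict p.surjective_rangeRestrict

lemma IsCoherentRing.finitePresentation_ker (hR : IsCoherentRing R) {k : ℕ} {M : Type u}
    [AddCommGroup M] [Module R M] [Module.FinitePresentation R M] (f : (Fin k → R) →ₗ[R] M)
    (hf : Function.Surjective f) : Module.FinitePresentation R (LinearMap.ker f) := by
  have : Module.Finite R (LinearMap.ker f) :=
    Module.Finite.of_fg (Module.FinitePresentation.fg_ker f hf)
  exact hR.finitePresentation_of_injective k _ (Submodule.injective_subtype (LinearMap.ker f))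

/-- Dualizing a presentation exhibits `M*` as the kernel of a matrix. Its image is finitely
presented by coherence, so the kernel is finitely generated. -/
lemma IsCoherentRing.finitePresentation_dual (hR : IsCoherentRing R) (M : Type u)
    [AddCommGroup M] [Module R M] [Module.FinitePresentation R M] :
    Module.FinitePresentation R (Module.Dual R M) := by
  obtain ⟨n, m, f, g, hf, hfg⟩ := Module.FinitePresentation.exists_fin' R M
  let e (k : ℕ) : Module.Dual R (Fin k → R) ≃ₗ[R] (Fin k → R) :=
    (Pi.basisFun R (Fin k)).toDualEquiv.symm
  let ψ : (Fin n → R) →ₗ[R] (Fin m → R) := (e m).toLinearMap ∘ₗ g.dualMap ∘ₗ (e n).symm.toLinearMap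
  have : Module.Finite R (LinearMap.range ψ) := Module.Finite.of_fg (Submodule.fg_range ψ)
  have : Module.FinitePresentation R (LinearMap.range ψ) :=
    hR.finitePresentation_of_injective m _ (Submodule.injective_subtype _)
  have hψ := Module.FinitePresentation.fg_ker _ ψ.surjective_rangeRestrict
  let ι : Module.Dual R M →ₗ[R] (Fin n → R) := (e n).toLinearMap ∘ₗ f.dualMap
  have hι : Function.Injective ι :=
    (e n).injective.comp (LinearMap.dualMap_injective_of_surjective hf)
  have hrange : LinearMap.range ι = LinearMap.ker ψ.rangeRestrict := by
    rw [LinearMap.ker_rangeRestrict]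
    ext x
    obtain ⟨φ, rfl⟩ := (e n).surjective x
    have h1 : (e n) φ ∈ LinearMap.range ι ↔ φ ∈ LinearMap.range f.dualMap := by
      simp [ι]
    have h2 : (e n) φ ∈ LinearMap.ker ψ ↔ φ ∈ LinearMap.ker g.dualMap := by
      simp [ψ]
    rw [h1, h2]
    exact (LinearMap.exact_lcomp_of_exact_of_surjective R hfg hf φ).symm
  have : Module.Finite R (Module.Dual R M) := by
    rw [← hrange] at hψ
    have := Module.Finite.of_fg hψ
    exact Module.Finite.equiv (LinearEquiv.ofInjective ι hι).symm
  exact hR.finitePresentation_of_injective n ι hι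

end Coherent

/-! ### Duals and Ext under flat base change -/

section HomBaseChange

variable {R : Type u} [CommRing R] (N : Type u) [AddCommGroup N] [Module R N]
  (S : Type u) [CommRing S] [Algebra R S]

/-- For `N` finitely presented and `S` flat, `Hom(N, S)` is the base change of `Hom(N, R)`. -/
lemma isBaseChange_dual [Module.FinitePresentation R N] [Module.Flat R S] :
    IsBaseChange S ((Algebra.linearMap R S).compRight R :
      Module.Dual R N →ₗ[R] (N →ₗ[R] S)) := by
  refine IsBaseChange.of_equiv ((Module.FinitePresentation.isBaseChange_map R N R S).equiv ≪≫ₗ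
    (LinearEquiv.congrRight (TensorProduct.AlgebraTensorModule.rid R S S)) ≪≫ₗ
    (LinearMap.liftBaseChangeEquiv S).symm) fun φ => ?_
  ext x
  rw [LinearEquiv.trans_apply, LinearEquiv.trans_apply, IsBaseChange.equiv_tmul, one_smul]
  change TensorProduct.AlgebraTensorModule.rid R S S (1 ⊗ₜ φ x) = algebraMap R S (φ x)
  simp [Algebra.algebraMap_eq_smul_one]

variable {N} {S} in
lemma mem_span_dual [Module.FinitePresentation R N] [Module.Flat R S] (φ : N →ₗ[R] S) :
    φ ∈ Submodule.span S (Set.range fun ψ : Module.Dual R N => (Algebra.linearMap R S) ∘ₗ ψ) := by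
  have h := isBaseChange_dual (R := R) N S
  obtain ⟨t, rfl⟩ := h.equiv.surjective φ
  induction t using TensorProduct.induction_on with
  | zero => simp
  | tmul s ψ =>
    rw [h.equiv_tmul]
    exact Submodule.smul_mem _ _ (Submodule.subset_span ⟨ψ, rfl⟩)
  | add x y hx hy => rw [map_add]; exact add_mem hx hy

/-- Dimension shifting along free covers, whose kernels stay finitely presented by coherence. In
degree one, maps from the kernel to `S` are `S`-combinations of maps to `R`, and those extend. -/
lemma ExtVanish.flat (hR : IsCoherentRing R) [Module.Flat R S] :
    ∀ (N : Type u) [AddCommGroup N] [Module R N] [Module.FinitePresentation R N],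
      (∀ i, 0 < i → ExtVanish R N R i) → ∀ i, 0 < i → ExtVanish R N S i := by
  intro N _ _ _ hN i hi
  obtain ⟨i, rfl⟩ := Nat.exists_eq_succ_of_ne_zero hi.ne'
  induction i generalizing N with
  | zero =>
    obtain ⟨k, f, hf⟩ := Module.Finite.exists_fin' R N
    have hK := hR.finitePresentation_ker f hf
    have hex := LinearMap.exact_subtype_ker_map f
    have hinj := Submodule.injective_subtype (LinearMap.ker f)
    refine .one_of_extension hinj hf hex (.of_projective one_pos) fun φ => ?_
    induction mem_span_dual φ using Submodule.span_induction with
    | mem φ hφ =>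
      obtain ⟨ψ, rfl⟩ := hφ
      obtain ⟨χ, rfl⟩ := ExtVanish.exists_extension hinj hf hex (hN 1 one_pos) ψ
      exact ⟨Algebra.linearMap R S ∘ₗ χ, rfl⟩
    | zero => exact ⟨0, LinearMap.zero_comp _⟩
    | add φ φ' _ _ h h' =>
      obtain ⟨χ, rfl⟩ := h
      obtain ⟨χ', rfl⟩ := h'
      exact ⟨χ + χ', LinearMap.add_comp _ _ _⟩
    | smul s φ _ h =>
      obtain ⟨χ, rfl⟩ := h
      exact ⟨s • χ, LinearMap.smul_comp _ _ _⟩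
  | succ i ih =>
    obtain ⟨k, f, hf⟩ := Module.Finite.exists_fin' R N
    have hK := hR.finitePresentation_ker f hf
    have hex := LinearMap.exact_subtype_ker_map f
    have hinj := Submodule.injective_subtype (LinearMap.ker f)
    refine .right_left hinj hf hex (ih _ (fun j hj => ?_) i.succ_pos) (.of_projective (by lia))
    exact .left_left hinj hf hex (.of_projective hj) (hN (j + 1) (by lia))

/-- For `M` reflexive with finitely presented dual and `S` flat, `S ⊗ M` is isomorphic to
`Hom(M*, S)`. -/
lemma exists_tensor_equiv_hom_dual (M : Type u) [AddCommGroup M] [Module R M]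
    (hM : Function.Bijective (Module.Dual.eval R M)) [Module.FinitePresentation R (Module.Dual R M)]
    [Module.Flat R S] :
    ∃ e : S ⊗[R] M ≃ₗ[S] (Module.Dual R M →ₗ[R] S),
      ∀ s m ψ, e (s ⊗ₜ m) ψ = s * algebraMap R S (ψ m) :=
  ⟨(LinearEquiv.ofBijective _ hM).baseChange R S _ _ ≪≫ₗ
    (isBaseChange_dual (R := R) (Module.Dual R M) S).equiv, fun s m ψ => by
      rw [LinearEquiv.trans_apply, LinearEquiv.baseChange_tmul, IsBaseChange.equiv_tmul]
      rfl⟩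

end HomBaseChange

/-! ### Hom modulo a regular sequence -/

section HomQuot

open scoped Pointwise

variable {R : Type u} [CommRing R] (N : Type u) [AddCommGroup N] [Module R N]
  {S : Type u} [CommRing S] [Algebra R S] {X : Type u} [AddCommGroup X] [Module R X] [Module S X]
  [IsScalarTower R S X]

/-- Composition with the quotient map `X → X ⧸ P`, as an `S`-linear map on `Hom(N, X)`. -/
def homMkQ (P : Submodule S X) : (N →ₗ[R] X) →ₗ[S] (N →ₗ[R] X ⧸ P) where
  toFun φ := (P.mkQ.restrictScalars R) ∘ₗ φ
  map_add' _ _ := LinearMap.comp_add _ _ _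
  map_smul' s φ := by
    ext x
    exact P.mkQ.map_smul s (φ x)

variable {N}

lemma homMkQ_apply (P : Submodule S X) (φ : N →ₗ[R] X) (x : N) :
    homMkQ N P φ x = P.mkQ (φ x) := rfl

lemma homMkQ_eq_zero_iff {P : Submodule S X} {φ : N →ₗ[R] X} :
    homMkQ N P φ = 0 ↔ ∀ x, φ x ∈ P := by
  rw [LinearMap.ext_iff]
  simp [homMkQ_apply]

lemma isSMulRegular_hom {y : S} (hy : IsSMulRegular X y) : IsSMulRegular (N →ₗ[R] X) y :=
  fun _ _ h => LinearMap.ext fun x => hy (LinearMap.congr_fun h x)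

/-- A map with values in `yX` can be divided by `y`, since multiplication by `y` identifies `X` with
`yX`. -/
lemma ker_homMkQ_smul_top {y : S} (hy : IsSMulRegular X y) :
    LinearMap.ker (homMkQ (R := R) N (y • (⊤ : Submodule S X))) = y • ⊤ := by
  ext φ
  rw [LinearMap.mem_ker, homMkQ_eq_zero_iff, Submodule.mem_smul_pointwise_iff_exists]
  constructor
  · intro h
    let l : X →ₗ[R] X := (LinearMap.lsmul S X y).restrictScalars R
    have hl : Function.Injective l := hy
    have hr : ∀ x, φ x ∈ LinearMap.range l := fun x => by
      obtain ⟨z, -, hz⟩ := (Submodule.mem_smul_pointwise_iff_exists _ _ _).1 (h x)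
      exact ⟨z, hz⟩
    refine ⟨(LinearEquiv.ofInjective l hl).symm.toLinearMap ∘ₗ φ.codRestrict _ hr, trivial, ?_⟩
    ext x
    exact congrArg Subtype.val ((LinearEquiv.ofInjective l hl).apply_symm_apply ⟨φ x, hr x⟩)
  · rintro ⟨ψ, -, rfl⟩ x
    exact Submodule.smul_mem_pointwise_smul _ _ _ trivial

lemma exact_restrictScalars_smul_mkQ (y : S) : Function.Exact
    ((LinearMap.lsmul S X y).restrictScalars R)
    ((y • (⊤ : Submodule S X)).mkQ.restrictScalars R) :=
  LinearMap.exact_lsmul_mkQ_smul_top X y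

lemma homMkQ_smul_top_surjective {y : S} (hy : IsSMulRegular X y) (h : ExtVanish R N X 1) :
    Function.Surjective (homMkQ (R := R) N (y • (⊤ : Submodule S X))) := by
  intro φ
  have hinj : Function.Injective ((LinearMap.lsmul S X y).restrictScalars R) := hy
  have hsurj : Function.Surjective ((y • (⊤ : Submodule S X)).mkQ.restrictScalars R) :=
    fun z => Submodule.mkQ_surjective (y • (⊤ : Submodule S X)) z
  exact h.exists_lift hinj hsurj (exact_restrictScalars_smul_mkQ y) φ

lemma ExtVanish.quotSMulTop {y : S} (hy : IsSMulRegular X y)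
    (h : ∀ i, 0 < i → ExtVanish R N X i) :
    ∀ i, 0 < i → ExtVanish R N (QuotSMulTop y X) i := by
  intro i hi
  have hinj : Function.Injective ((LinearMap.lsmul S X y).restrictScalars R) := hy
  have hsurj : Function.Surjective ((y • (⊤ : Submodule S X)).mkQ.restrictScalars R) :=
    fun z => Submodule.mkQ_surjective (y • (⊤ : Submodule S X)) z
  exact .right_right hinj hsurj (exact_restrictScalars_smul_mkQ y) (h i hi) (h (i + 1) (by lia))

/-- If `Extⁱ(N, X) = 0` for `i > 0`, then `Hom(N, -)` commutes with killing an `X`-regular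
sequence, and the sequence is regular on `Hom(N, X)`. -/
lemma hom_quot_ofList {rs : List S} (hrs : IsWeaklyRegular X rs)
    (h : ∀ i, 0 < i → ExtVanish R N X i) :
    IsWeaklyRegular (N →ₗ[R] X) rs ∧
      Function.Surjective (homMkQ (R := R) N (Ideal.ofList rs • (⊤ : Submodule S X))) ∧
      LinearMap.ker (homMkQ (R := R) N (Ideal.ofList rs • (⊤ : Submodule S X))) =
        Ideal.ofList rs • ⊤ := by
  induction rs generalizing X with
  | nil =>
    refine ⟨.nil _ _, fun φ => ?_, ?_⟩
    · have hbot : Ideal.ofList ([] : List S) • (⊤ : Submodule S X) = ⊥ := by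
        rw [Ideal.ofList_nil, Submodule.bot_smul]
      refine ⟨((Submodule.quotEquivOfEqBot _ hbot).toLinearMap.restrictScalars R) ∘ₗ φ, ?_⟩
      ext x
      exact (Submodule.quotEquivOfEqBot _ hbot).symm_apply_apply (φ x)
    · rw [Ideal.ofList_nil, Submodule.bot_smul, Submodule.bot_smul, eq_bot_iff]
      intro φ hφ
      rw [LinearMap.mem_ker, homMkQ_eq_zero_iff] at hφ
      rw [Submodule.mem_bot]
      ext x
      simpa using hφ x
  | cons y rs ih =>
    rw [isWeaklyRegular_cons_iff] at hrs
    obtain ⟨h1, h2, h3⟩ := ih hrs.2 (ExtVanish.quotSMulTop hrs.1 h)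
    have hsurj := homMkQ_smul_top_surjective hrs.1 (h 1 one_pos)
    have hker := ker_homMkQ_smul_top (R := R) (N := N) hrs.1
    -- Here `Ext¹(N, X) = 0` enters: it makes every map to `X/yX` lift.
    let e : QuotSMulTop y (N →ₗ[R] X) ≃ₗ[S] (N →ₗ[R] QuotSMulTop y X) :=
      Submodule.quotEquivOfEq _ _ hker.symm ≪≫ₗ LinearMap.quotKerEquivOfSurjective _ hsurj
    let q := Submodule.quotOfListConsSMulTopEquivQuotSMulTopInner X y rs
    refine ⟨?_, fun φ => ?_, ?_⟩
    · rw [isWeaklyRegular_cons_iff]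
      exact ⟨isSMulRegular_hom hrs.1, (e.isWeaklyRegular_congr rs).2 h1⟩
    · obtain ⟨ψ, hψ⟩ := h2 ((q.toLinearMap.restrictScalars R) ∘ₗ φ)
      obtain ⟨χ, rfl⟩ := hsurj ψ
      refine ⟨χ, ?_⟩
      ext x
      exact q.injective (LinearMap.congr_fun hψ x)
    · refine le_antisymm (fun φ hφ => ?_) ?_
      · have h4 : homMkQ N (Ideal.ofList rs • (⊤ : Submodule S (QuotSMulTop y X)))
            (homMkQ N (y • (⊤ : Submodule S X)) φ) = 0 := by
          ext x
          exact congrArg q (LinearMap.congr_fun (LinearMap.mem_ker.1 hφ) x)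
        rw [← LinearMap.mem_ker, h3, ← LinearMap.range_eq_top.2 hsurj, ← Submodule.map_top,
          ← Submodule.map_smul''] at h4
        obtain ⟨ψ, hψ, h5⟩ := h4
        rw [Ideal.ofList_cons_smul, sup_comm, ← hker]
        rw [← sub_eq_zero, ← map_sub] at h5
        rw [← sub_sub_cancel ψ φ]
        exact sub_mem (Submodule.mem_sup_left hψ) (Submodule.mem_sup_right h5)
      · rw [Submodule.smul_le]
        intro a ha φ _
        rw [LinearMap.mem_ker, homMkQ_eq_zero_iff]
        exact fun x => Submodule.smul_mem_smul ha trivial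

end HomQuot

/-! ### Nonzero maps out of finitely presented modules -/

section Local

variable {R : Type u} [CommRing R]

lemma exists_fg_ne_top_sup_span_eq_top (N : Type u) [AddCommGroup N] [Module R N] [Nontrivial N]
    [Module.Finite R N] : ∃ (L : Submodule R N) (x : N), L.FG ∧ L ≠ ⊤ ∧ L ⊔ R ∙ x = ⊤ := by
  classical
  obtain ⟨s, hs⟩ : (⊤ : Submodule R N).FG := Module.Finite.fg_top
  induction s using Finset.induction_on with
  | empty => exact absurd hs (by simp)
  | insert x s _ ih =>
    by_cases h : Submodule.span R (s : Set N) = ⊤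
    · exact ih h
    · refine ⟨_, x, ⟨s, rfl⟩, h, ?_⟩
      rw [← hs, Finset.coe_insert, Submodule.span_insert, sup_comm]

/-- If every finitely generated proper ideal of the local ring `R` has torsion on `A`, then every
nonzero finitely presented module admits a nonzero map to `A`. -/
lemma exists_hom_ne_zero [IsLocalRing R] {A : Type u} [AddCommGroup A] [Module R A]
    (hA : ∀ J : Ideal R, J.FG → J ≤ IsLocalRing.maximalIdeal R →
      ∃ a : A, a ≠ 0 ∧ ∀ j ∈ J, j • a = 0)
    (N : Type u) [AddCommGroup N] [Module R N] [Nontrivial N] [Module.FinitePresentation R N] :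
    ∃ φ : N →ₗ[R] A, φ ≠ 0 := by
  obtain ⟨L, x, hL, hLtop, hLx⟩ := exists_fg_ne_top_sup_span_eq_top (R := R) N
  -- `N/L` is cyclic, nonzero and finitely presented, so it is `R/I` with `I` proper and finitely
  -- generated. An element of `A` killed by `I` then defines a map.
  have : Module.FinitePresentation R (N ⧸ L) :=
    Module.finitePresentation_of_surjective L.mkQ L.mkQ_surjective (by rwa [Submodule.ker_mkQ])
  let p : R →ₗ[R] N ⧸ L := LinearMap.toSpanSingleton R _ (L.mkQ x)
  have hp : Function.Surjective p := by
    rw [← LinearMap.range_eq_top, LinearMap.range_toSpanSingleton, ← Set.image_singleton,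
      ← Submodule.map_span, ← L.range_mkQ, ← Submodule.map_top, ← hLx, Submodule.map_sup,
      Submodule.mkQ_map_self, bot_sup_eq]
  have hI : LinearMap.ker p ≤ IsLocalRing.maximalIdeal R := by
    refine IsLocalRing.le_maximalIdeal fun htop => hLtop ?_
    rw [← Submodule.Quotient.subsingleton_iff]
    refine subsingleton_of_forall_eq 0 fun z => ?_
    obtain ⟨r, rfl⟩ := hp z
    exact LinearMap.mem_ker.1 (htop ▸ Submodule.mem_top)
  obtain ⟨a, ha, haI⟩ := hA _ (Module.FinitePresentation.fg_ker p hp) hI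
  let φ : N ⧸ L →ₗ[R] A := (LinearMap.ker p).liftQ (LinearMap.toSpanSingleton R A a)
    (fun j hj => LinearMap.mem_ker.2 (haI j hj)) ∘ₗ
    (p.quotKerEquivOfSurjective hp).symm.toLinearMap
  have hφ : φ (L.mkQ x) = a := by
    have h1 : (p.quotKerEquivOfSurjective hp) (Submodule.Quotient.mk 1) = L.mkQ x :=
      (p.quotKerEquivOfSurjective_apply_mk hp 1).trans (one_smul R _)
    rw [← h1]
    rw [LinearMap.comp_apply, LinearEquiv.coe_coe, LinearEquiv.symm_apply_apply]
    exact one_smul R a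
  refine ⟨φ ∘ₗ L.mkQ, fun h => ha ?_⟩
  rw [← hφ]
  exact LinearMap.congr_fun h x

end Local

/-! ### Closure properties of the G-class -/

section GClass

variable {R : Type u} [CommRing R] {A B C : Type u} [AddCommGroup A] [AddCommGroup B]
  [AddCommGroup C] [Module R A] [Module R B] [Module R C] {f : A →ₗ[R] B} {g : B →ₗ[R] C}

lemma exists_comp_eq_of_exact {X : Type*} [AddCommGroup X] [Module R X]
    (hf : Function.Injective f) (h : Function.Exact f g) (φ : X →ₗ[R] B) (hφ : g ∘ₗ φ = 0) :
    ∃ ψ : X →ₗ[R] A, f ∘ₗ ψ = φ := by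
  refine ⟨(LinearEquiv.ofInjective f hf).symm.toLinearMap ∘ₗ
    φ.codRestrict _ fun x => (h _).1 (LinearMap.congr_fun hφ x), ?_⟩
  ext x
  exact congrArg Subtype.val ((LinearEquiv.ofInjective f hf).apply_symm_apply _)

lemma IsGClass.isReflexive (h : IsGClass R A) : Module.IsReflexive R A := ⟨h.bijective_eval⟩

lemma IsGClass.congr (e : A ≃ₗ[R] B) (h : IsGClass R A) : IsGClass R B where
  finite := have := h.finite; Module.Finite.equiv e
  ext_eq_zero i hi := ExtVanish.congr_left e (h.ext_eq_zero i hi)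
  ext_dual_eq_zero i hi := ExtVanish.congr_left e.symm.dualMap (h.ext_dual_eq_zero i hi)
  bijective_eval := have := h.isReflexive; (Module.equiv e).bijective_dual_eval'

lemma IsGClass.of_projective [Module.Finite R A] [Module.Projective R A] : IsGClass R A where
  finite := inferInstance
  ext_eq_zero _ hi := ExtVanish.of_projective hi
  ext_dual_eq_zero _ hi := ExtVanish.of_projective hi
  bijective_eval := Module.bijective_dual_eval R A

lemma IsGClass.prod (hA : IsGClass R A) (hB : IsGClass R B) : IsGClass R (A × B) where
  finite := have := hA.finite; have := hB.finite; inferInstance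
  ext_eq_zero i hi := ExtVanish.middle_left (f := LinearMap.inl R A B) (g := LinearMap.snd R A B)
    LinearMap.inl_injective LinearMap.snd_surjective .inl_snd (hA.ext_eq_zero i hi)
      (hB.ext_eq_zero i hi)
  ext_dual_eq_zero i hi := ExtVanish.congr_left (Module.dualProdDualEquivDual R A B)
    (ExtVanish.middle_left (f := LinearMap.inl R _ _) (g := LinearMap.snd R _ _)
      LinearMap.inl_injective LinearMap.snd_surjective .inl_snd (hA.ext_dual_eq_zero i hi)
        (hB.ext_dual_eq_zero i hi))
  bijective_eval :=
    have := hA.isReflexive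
    have := hB.isReflexive
    Module.bijective_dual_eval R (A × B)

lemma exact_dualMap (h : Function.Exact f g) (hg : Function.Surjective g) :
    Function.Exact g.dualMap f.dualMap :=
  LinearMap.exact_lcomp_of_exact_of_surjective R h hg

variable (hf : Function.Injective f) (hg : Function.Surjective g) (h : Function.Exact f g)
include hf hg h

/-- The kernel of a surjection between modules of the G-class belongs to the G-class, as soon as it
is finitely generated. -/
lemma IsGClass.left [Module.Finite R A] (hB : IsGClass R B) (hC : IsGClass R C) :
    IsGClass R A := by
  have hsurj : Function.Surjective f.dualMap :=
    ExtVanish.exists_extension hf hg h (hC.ext_eq_zero 1 one_pos)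
  have hinj : Function.Injective g.dualMap := LinearMap.dualMap_injective_of_surjective hg
  have hex := exact_dualMap h hg
  refine ⟨inferInstance, fun i hi => ?_, fun i hi => ?_, fun a a' haa => ?_, fun α => ?_⟩
  · exact ExtVanish.left_left hf hg h (hB.ext_eq_zero i hi) (hC.ext_eq_zero (i + 1) (by lia))
  · obtain ⟨i, rfl⟩ := Nat.exists_eq_succ_of_ne_zero hi.ne'
    cases i with
    | zero =>
      -- By reflexivity a functional on `C*` is evaluation at some `c`; evaluation at a preimage of
      -- `c` in `B` extends it to `B*`.
      refine ExtVanish.one_of_extension hinj hsurj hex (hB.ext_dual_eq_zero 1 one_pos) fun φ => ?_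
      obtain ⟨c, rfl⟩ := hC.bijective_eval.2 φ
      obtain ⟨b, rfl⟩ := hg c
      exact ⟨Module.Dual.eval R B b, rfl⟩
    | succ i =>
      exact ExtVanish.right_left hinj hsurj hex (hC.ext_dual_eq_zero (i + 1) (by lia))
        (hB.ext_dual_eq_zero (i + 1 + 1) (by lia))
  · refine hf (hB.bijective_eval.1 (LinearMap.ext fun ψ => ?_))
    exact LinearMap.congr_fun haa (ψ ∘ₗ f)
  · obtain ⟨b, hb⟩ := hB.bijective_eval.2 (α ∘ₗ f.dualMap)
    have hgb : g b = 0 := by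
      refine hC.bijective_eval.1 (LinearMap.ext fun ψ => ?_)
      refine (LinearMap.congr_fun hb (g.dualMap ψ)).trans ?_
      rw [LinearMap.comp_apply, hex.apply_apply_eq_zero, map_zero, map_zero]
      rfl
    obtain ⟨a, rfl⟩ := (h b).1 hgb
    refine ⟨a, LinearMap.ext fun χ => ?_⟩
    obtain ⟨ψ, rfl⟩ := hsurj χ
    exact LinearMap.congr_fun hb ψ

/-- `Ext¹(C, R) = 0` keeps the dual sequence exact, and `Ext¹(A*, R) = 0` keeps the double dual
exact, so reflexivity passes to `C`. This makes `Ext¹(C, R)` the only obstruction. -/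
lemma IsGClass.right (hA : IsGClass R A) (hB : IsGClass R B) (hC : ExtVanish R C R 1) :
    IsGClass R C := by
  have hsurj : Function.Surjective f.dualMap := ExtVanish.exists_extension hf hg h hC
  have hinj : Function.Injective g.dualMap := LinearMap.dualMap_injective_of_surjective hg
  have hex := exact_dualMap h hg
  have hfin := hB.finite
  refine ⟨.of_surjective g hg, fun i hi => ?_, fun i hi => ?_, ?_, fun α => ?_⟩
  · obtain ⟨i, rfl⟩ := Nat.exists_eq_succ_of_ne_zero hi.ne'
    cases i with
    | zero => exact hC
    | succ i =>
      exact ExtVanish.right_left hf hg h (hA.ext_eq_zero (i + 1) (by lia))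
        (hB.ext_eq_zero (i + 1 + 1) (by lia))
  · exact ExtVanish.left_left hinj hsurj hex (hB.ext_dual_eq_zero i hi)
      (hA.ext_dual_eq_zero (i + 1) (by lia))
  · rw [injective_iff_map_eq_zero]
    intro c hc
    obtain ⟨b, rfl⟩ := hg c
    have h1 : Module.Dual.eval R B b ∘ₗ g.dualMap = 0 := hc
    obtain ⟨γ, hγ⟩ := (LinearMap.exact_lcomp_of_exact_of_surjective R hex hsurj
      (Module.Dual.eval R B b)).1 h1
    obtain ⟨a, rfl⟩ := hA.bijective_eval.2 γ
    have h2 : f a = b := hB.bijective_eval.1 (LinearMap.ext fun ψ => LinearMap.congr_fun hγ ψ)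
    rw [← h2]
    exact h.apply_apply_eq_zero a
  · obtain ⟨β, rfl⟩ := ExtVanish.exists_extension hinj hsurj hex (hA.ext_dual_eq_zero 1 one_pos) α
    obtain ⟨b, rfl⟩ := hB.bijective_eval.2 β
    exact ⟨g b, rfl⟩

end GClass

/-! ### G-resolutions and free syzygies -/

section Resolutions

variable {R : Type u} [CommRing R]

/-- `M` has a resolution of length at most `n` by modules of the G-class. -/
def HasGRes (R : Type u) [CommRing R] :
    ℕ → ∀ (M : Type u) [AddCommGroup M] [Module R M], Prop
  | 0, M, _, _ => IsGClass R M
  | n + 1, M, _, _ => ∃ (G : Type u) (_ : AddCommGroup G) (_ : Module R G) (K : Type u)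
      (_ : AddCommGroup K) (_ : Module R K) (i : K →ₗ[R] G) (p : G →ₗ[R] M),
      IsGClass R G ∧ Function.Injective i ∧ Function.Surjective p ∧ Function.Exact i p ∧
        HasGRes R n K

/-- `M` has an `n`-th syzygy, with respect to finite free modules, which is finitely presented and
belongs to the G-class. -/
def HasGSyzygy (R : Type u) [CommRing R] :
    ℕ → ∀ (M : Type u) [AddCommGroup M] [Module R M], Prop
  | 0, M, _, _ => Module.FinitePresentation R M ∧ IsGClass R M
  | n + 1, M, _, _ => ∃ (k : ℕ) (p : (Fin k → R) →ₗ[R] M), Function.Surjective p ∧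
      HasGSyzygy R n (LinearMap.ker p)

variable {M : Type u} [AddCommGroup M] [Module R M]

lemma HasGRes.finite {n : ℕ} (h : HasGRes R n M) : Module.Finite R M := by
  cases n with
  | zero => exact IsGClass.finite h
  | succ n =>
    obtain ⟨G, _, _, K, _, _, i, p, hG, -, hp, -⟩ := h
    have := hG.finite
    exact .of_surjective p hp

lemma HasGRes.prod_free {F : Type u} [AddCommGroup F] [Module R F] (hF : IsGClass R F) {n : ℕ}
    (h : HasGRes R n M) : HasGRes R n (M × F) := by
  cases n with
  | zero => exact IsGClass.prod h hF
  | succ n =>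
    obtain ⟨G, _, _, K, _, _, i, p, hG, hi, hp, hip, hK⟩ := h
    refine ⟨G × F, _, _, K, _, _, LinearMap.inl R G F ∘ₗ i, p.prodMap LinearMap.id, hG.prod hF,
      LinearMap.inl_injective.comp hi, hp.prodMap Function.surjective_id, ?_, hK⟩
    rintro ⟨x, y⟩
    simp only [LinearMap.prodMap_apply, LinearMap.id_apply, Prod.mk_eq_zero, hip x, Set.mem_range,
      LinearMap.comp_apply, LinearMap.inl_apply, Prod.mk.injEq]
    constructor
    · rintro ⟨⟨a, ha⟩, rfl⟩
      exact ⟨a, ha, rfl⟩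
    · rintro ⟨a, ha, rfl⟩
      exact ⟨⟨a, ha⟩, rfl⟩

lemma HasGRes.left {K P G : Type u} [AddCommGroup K] [AddCommGroup P] [AddCommGroup G]
    [Module R K] [Module R P] [Module R G] [Module.Finite R K] {f : K →ₗ[R] P} {g : P →ₗ[R] G}
    (hf : Function.Injective f) (hg : Function.Surjective g) (h : Function.Exact f g)
    (hG : IsGClass R G) {n : ℕ} (hP : HasGRes R n P) : HasGRes R n K := by
  cases n with
  | zero => exact IsGClass.left hf hg h hP hG
  | succ n =>
    obtain ⟨G', _, _, L, _, _, i, p, hG', hi, hp, hip, hL⟩ := hP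
    -- `H` is the preimage of `K` in `G'`. It is in the G-class as the kernel of `G' → G`, and `0 →
    -- L → H → K → 0` is exact.
    let H := LinearMap.ker (g ∘ₗ p)
    obtain ⟨q, hq⟩ := exists_comp_eq_of_exact hf h (p ∘ₗ H.subtype) (LinearMap.ext fun x => x.2)
    have hq' (x : H) : f (q x) = p x := LinearMap.congr_fun hq x
    let j : L →ₗ[R] H := i.codRestrict H fun x => by
      rw [LinearMap.mem_ker, LinearMap.comp_apply, hip.apply_apply_eq_zero, map_zero]
    have hj : Function.Injective j := fun x y hxy => hi (congrArg Subtype.val hxy)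
    have hqs : Function.Surjective q := by
      intro x
      obtain ⟨y, hy⟩ := hp (f x)
      have hyH : y ∈ H := by
        rw [LinearMap.mem_ker, LinearMap.comp_apply, hy, h.apply_apply_eq_zero]
      refine ⟨⟨y, hyH⟩, hf ?_⟩
      rw [hq', hy]
    have hjq : Function.Exact j q := by
      intro x
      rw [← (map_eq_zero_iff f hf), hq', hip]
      exact ⟨fun ⟨a, ha⟩ => ⟨a, Subtype.ext ha⟩, fun ⟨a, ha⟩ => ⟨a, congrArg Subtype.val ha⟩⟩
    have hfinL := hL.finite
    have hfinH : Module.Finite R H := by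
      refine ⟨Submodule.fg_of_fg_map_of_fg_inf_ker q ?_ ?_⟩
      · rw [Submodule.map_top, LinearMap.range_eq_top.2 hqs]
        exact Module.Finite.fg_top
      · rw [top_inf_eq, LinearMap.exact_iff.1 hjq]
        exact Submodule.fg_range j
    exact ⟨H, _, _, L, _, _, j, q, IsGClass.left H.injective_subtype (hg.comp hp)
      (LinearMap.exact_subtype_ker_map _) hG' hG, hj, hqs, hjq, hL⟩

/-- Schanuel's argument: lifting `f` through `p` gives an exact sequence `0 → ker f → K × Rᵏ → G →
0`, to which `HasGRes.left` applies. -/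
lemma HasGRes.ker {n : ℕ} (h : HasGRes R (n + 1) M) {k : ℕ} (f : (Fin k → R) →ₗ[R] M)
    (hf : Function.Surjective f) [Module.Finite R (LinearMap.ker f)] :
    HasGRes R n (LinearMap.ker f) := by
  obtain ⟨G, _, _, K, _, _, i, p, hG, hi, hp, hip, hK⟩ := h
  obtain ⟨σ, hσ⟩ := Module.projective_lifting_property p f hp
  have hσ' (x) : p (σ x) = f x := LinearMap.congr_fun hσ x
  obtain ⟨τ, hτ⟩ := exists_comp_eq_of_exact hi hip (σ ∘ₗ (LinearMap.ker f).subtype)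
    (LinearMap.ext fun x => (hσ' _).trans x.2)
  have hτ' (x) : i (τ x) = σ x := LinearMap.congr_fun hτ x
  refine HasGRes.left (P := K × (Fin k → R)) (f := (-τ).prod (LinearMap.ker f).subtype)
    (g := i.coprod σ) (fun x y hxy => Subtype.ext (congrArg Prod.snd hxy)) (fun y => ?_) ?_ hG
    (hK.prod_free .of_projective)
  · obtain ⟨x, hx⟩ := hf (p y)
    obtain ⟨a, ha⟩ := (hip (y - σ x)).1 (by rw [map_sub, hσ', hx, sub_self])
    exact ⟨(a, x), by simp [ha]⟩
  · rintro ⟨a, x⟩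
    constructor
    · intro hax
      rw [LinearMap.coprod_apply] at hax
      have hx : f x = 0 := by
        have := congrArg p hax
        rwa [map_add, hip.apply_apply_eq_zero, zero_add, hσ', map_zero] at this
      refine ⟨⟨x, hx⟩, Prod.ext (hi ?_) rfl⟩
      change i (-τ ⟨x, hx⟩) = i a
      rw [map_neg, hτ']
      exact neg_eq_of_add_eq_zero_left hax
    · rintro ⟨z, hz⟩
      rw [← hz]
      change i (-τ z) + σ z = 0
      rw [map_neg, hτ', neg_add_cancel]

lemma HasGRes.hasGSyzygy (hR : IsCoherentRing R) {n : ℕ} (h : HasGRes R n M)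
    [hM : Module.FinitePresentation R M] : HasGSyzygy R n M := by
  induction n generalizing M with
  | zero => exact ⟨hM, h⟩
  | succ n ih =>
    obtain ⟨k, f, hf⟩ := Module.Finite.exists_fin' R M
    have := hR.finitePresentation_ker f hf
    exact ⟨k, f, hf, ih (h.ker f hf)⟩

lemma GResolution.length_le_iff (P : GResolution R M) (n : ℕ) :
    P.length ≤ n ↔ ∀ m, n < m → Subsingleton (P.G m) := by
  rw [GResolution.length, iSup₂_le_iff]
  refine forall_congr' fun m => ?_
  rw [← not_nontrivial_iff_subsingleton, Nat.cast_le, ← not_lt]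
  tauto

/-- Truncation of a G-resolution of `M` to one of the first syzygy. -/
def GResolution.tail (P : GResolution R M) : GResolution R (LinearMap.ker P.aug) where
  G n := P.G (n + 1)
  d n := P.d (n + 1)
  aug := (P.d 0).codRestrict _ P.exact_aug.apply_apply_eq_zero
  isGClass n := P.isGClass (n + 1)
  exact_d n := P.exact_d (n + 1)
  exact_aug x := by rw [← P.exact_d 0 x, Subtype.ext_iff]; rfl
  surjective_aug x := by
    obtain ⟨y, hy⟩ := (P.exact_aug x).1 x.2
    exact ⟨y, Subtype.ext hy⟩

lemma GResolution.hasGRes {n : ℕ} (P : GResolution R M) (h : P.length ≤ n) : HasGRes R n M := by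
  rw [GResolution.length_le_iff] at h
  induction n generalizing M with
  | zero =>
    have := h 1 one_pos
    refine (P.isGClass 0).congr (LinearEquiv.ofBijective P.aug ⟨?_, P.surjective_aug⟩)
    rw [injective_iff_map_eq_zero]
    intro x hx
    obtain ⟨y, rfl⟩ := (P.exact_aug x).1 hx
    rw [Subsingleton.elim y 0, map_zero]
  | succ n ih =>
    exact ⟨P.G 0, _, _, _, _, _, (LinearMap.ker P.aug).subtype, P.aug, P.isGClass 0,
      Submodule.injective_subtype _, P.surjective_aug, LinearMap.exact_subtype_ker_map _,
      ih P.tail fun m hm => h (m + 1) (by lia)⟩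

/-- A module of the G-class as its own G-resolution. -/
def GResolution.self (h : IsGClass R M) : GResolution R M where
  G
    | 0 => ModuleCat.of R M
    | _ + 1 => ModuleCat.of R PUnit
  d _ := 0
  aug := LinearMap.id
  isGClass
    | 0 => h
    | _ + 1 => .of_projective
  exact_d _ _ := ⟨fun _ => ⟨0, Subsingleton.elim (α := PUnit) _ _⟩, fun _ => rfl⟩
  exact_aug _ := ⟨fun hx => ⟨0, hx.symm⟩, fun ⟨_, hy⟩ => hy.symm⟩
  surjective_aug := Function.surjective_id

/-- Extension of a G-resolution of a first syzygy by one step. -/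
def GResolution.cons {G K : Type u} [AddCommGroup G] [AddCommGroup K] [Module R G] [Module R K]
    (hG : IsGClass R G) {i : K →ₗ[R] G} {p : G →ₗ[R] M} (hi : Function.Injective i)
    (hp : Function.Surjective p) (hip : Function.Exact i p) (P : GResolution R K) :
    GResolution R M where
  G
    | 0 => ModuleCat.of R G
    | n + 1 => P.G n
  d
    | 0 => i ∘ₗ P.aug
    | n + 1 => P.d n
  aug := p
  isGClass
    | 0 => hG
    | n + 1 => P.isGClass n
  exact_d
    | 0 => fun x => (map_eq_zero_iff i hi).trans (P.exact_aug x)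
    | n + 1 => P.exact_d n
  exact_aug x := (hip x).trans ⟨fun ⟨y, hy⟩ => by
    obtain ⟨z, rfl⟩ := P.surjective_aug y
    exact ⟨z, hy⟩, fun ⟨z, hz⟩ => ⟨P.aug z, hz⟩⟩
  surjective_aug := hp

lemma HasGRes.exists_gResolution {n : ℕ} (h : HasGRes R n M) :
    ∃ P : GResolution R M, P.length ≤ n := by
  simp only [GResolution.length_le_iff]
  induction n generalizing M with
  | zero =>
    refine ⟨.self h, fun m hm => ?_⟩
    obtain ⟨m, rfl⟩ := Nat.exists_eq_succ_of_ne_zero hm.ne'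
    exact inferInstanceAs (Subsingleton PUnit)
  | succ n ih =>
    obtain ⟨G, _, _, K, _, _, i, p, hG, hi, hp, hip, hK⟩ := h
    obtain ⟨P, hP⟩ := ih hK
    refine ⟨.cons hG hi hp hip P, fun m hm => ?_⟩
    obtain ⟨m, rfl⟩ := Nat.exists_eq_succ_of_ne_zero (Nat.ne_zero_of_lt hm)
    exact hP m (by lia)

lemma gdim_le_iff (n : ℕ) : Gdim R M ≤ n ↔ HasGRes R n M := by
  constructor
  · intro h
    -- The strict inequality selects an actual resolution from the infimum.
    have h1 : Gdim R M < (n + 1 : ℕ) := lt_of_le_of_lt h (by exact_mod_cast n.lt_succ_self)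
    obtain ⟨P, hP⟩ := iInf_lt_iff.1 h1
    exact P.hasGRes (ENat.lt_natCast_add_one_iff.1 (by exact_mod_cast hP))
  · intro h
    obtain ⟨P, hP⟩ := h.exists_gResolution
    exact iInf_le_of_le P hP

end Resolutions

/-! ### Prolonging regular sequences -/

lemma isWeaklyRegular_of_retract {T : Type*} [CommRing T] {A B : Type*} [AddCommGroup A]
    [AddCommGroup B] [Module T A] [Module T B] (i : A →ₗ[T] B) (p : B →ₗ[T] A)
    (h : p ∘ₗ i = LinearMap.id) {rs : List T} (hB : IsWeaklyRegular B rs) :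
    IsWeaklyRegular A rs := by
  induction rs generalizing A B with
  | nil => exact .nil _ _
  | cons y rs ih =>
    rw [isWeaklyRegular_cons_iff] at hB ⊢
    refine ⟨hB.1.of_injective i (Function.LeftInverse.injective (LinearMap.congr_fun h)),
      ih (QuotSMulTop.map y i) (QuotSMulTop.map y p) ?_ hB.2⟩
    rw [← QuotSMulTop.map_comp, h, QuotSMulTop.map_id]

section DepthGE

variable {R : Type u} [CommRing R] {I : Ideal R} {A B M : Type u} [AddCommGroup A]
  [AddCommGroup B] [AddCommGroup M] [Module R A] [Module R B] [Module R M] {r s : ℕ}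

lemma smul_eq_zero_of_mem_map {T : Type*} [CommRing T] [Algebra R T] {X : Type*} [AddCommGroup X]
    [Module R X] [Module T X] [IsScalarTower R T X] {J : Ideal R} {x : X}
    (hx : ∀ j ∈ J, j • x = 0) {a : T} (ha : a ∈ J.map (algebraMap R T)) : a • x = 0 := by
  induction ha using Submodule.span_induction with
  | mem a ha =>
    obtain ⟨j, hj, rfl⟩ := ha
    rw [algebraMap_smul, hx j hj]
  | zero => exact zero_smul T x
  | add a b _ _ ha hb => rw [add_smul, ha, hb, add_zero]
  | smul c a _ ha => rw [smul_assoc, ha, smul_zero]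

lemma DepthGE.exists_isWeaklyRegular_gradeGE (hA : DepthGE I r A) (hB : DepthGE I s B) :
    ∃ (T : Type u) (_ : CommRing T) (_ : Algebra R T) (_ : Module.FaithfullyFlat R T)
      (J : Ideal R) (rs : List T), J.FG ∧ J ≤ I ∧ rs.length = r ∧
        (∀ y ∈ rs, y ∈ J.map (algebraMap R T)) ∧ IsWeaklyRegular (T ⊗[R] A) rs ∧
          GradeGE (J.map (algebraMap R T)) s (T ⊗[R] B) := by
  obtain ⟨S, _, _, _, J, hJ, hJI, h⟩ := hA.combine hB
  obtain ⟨T, _, _, _, rs, hrs, hrsJ, hreg⟩ := exists_isWeaklyRegular_of_gradeGE r S (S ⊗[R] A)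
    (J.map (algebraMap R S)) (hJ.map _) fun T _ _ _ => by
      algebraize [(algebraMap S T).comp (algebraMap R S)]
      rw [Ideal.map_map, ← IsScalarTower.algebraMap_eq]
      exact (h T).1.congr (TensorProduct.AlgebraTensorModule.cancelBaseChange R S T T A).symm
  algebraize [(algebraMap S T).comp (algebraMap R S)]
  rw [Ideal.map_map, ← IsScalarTower.algebraMap_eq] at hrsJ
  have : Module.FaithfullyFlat R T := .trans R S T
  exact ⟨T, _, _, this, J, rs, hJ, hJI, hrs, hrsJ,
    ((TensorProduct.AlgebraTensorModule.cancelBaseChange R S T T A).isWeaklyRegular_congr _).1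
      hreg, (h T).2⟩

open Polynomial in
/-- A weakly regular sequence can be prolonged, after a faithfully flat base change, if the
quotient by the sequence has no torsion with respect to a finitely generated ideal. -/
lemma DepthGE.succ_of_forall_eq_zero {T : Type u} [CommRing T] [Algebra R T]
    [Module.FaithfullyFlat R T] {X : Type u} [AddCommGroup X] [Module R X] [Module T X]
    [IsScalarTower R T X] (e : T ⊗[R] M ≃ₗ[T] X) {rs : List T}
    (hI : ∀ y ∈ rs, y ∈ I.map (algebraMap R T)) (hrs : IsWeaklyRegular X rs) {J : Ideal R}
    (hJ : J.FG) (hJI : J ≤ I)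
    (h : ∀ a : X ⧸ (Ideal.ofList rs • ⊤ : Submodule T X), (∀ j ∈ J, j • a = 0) → a = 0) :
    DepthGE I (rs.length + 1) M := by
  obtain ⟨f, hfJ, hf⟩ := exists_polynomial_isSMulRegular
    (M := X ⧸ (Ideal.ofList rs • ⊤ : Submodule T X)) (hJ.map (algebraMap R T)) fun a ha =>
      h a fun j hj =>
        (algebraMap_smul T j a).symm.trans (ha _ (Ideal.mem_map_of_mem _ hj))
  have : Module.FaithfullyFlat T T[X] := .of_linearEquiv _ _ (basisMonomials T).repr
  have : Module.FaithfullyFlat R T[X] := .trans R T T[X]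
  let e' : T[X] ⊗[R] M ≃ₗ[T[X]] T[X] ⊗[T] X :=
    (TensorProduct.AlgebraTensorModule.cancelBaseChange R T T[X] T[X] M).symm ≪≫ₗ
      e.baseChange T T[X] _ _
  have hreg : IsWeaklyRegular (T[X] ⊗[T] X) (rs.map (algebraMap T T[X]) ++ [f]) := by
    rw [isWeaklyRegular_append_iff, isWeaklyRegular_singleton_iff]
    refine ⟨hrs.of_flat_of_isBaseChange (TensorProduct.isBaseChange T X T[X]), ?_⟩
    rw [← Ideal.map_ofList]
    exact ((TensorProduct.tensorQuotMapSMulEquivTensorQuot X T[X]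
      (Ideal.ofList rs)).isSMulRegular_congr f).2 hf
  have h1 := DepthGE.of_isWeaklyRegular (I := I) (S := T[X]) (M := M)
    (rs := rs.map (algebraMap T T[X]) ++ [f]) (fun y hy => ?_)
    ((e'.isWeaklyRegular_congr _).2 hreg)
  · simpa using h1
  · rw [IsScalarTower.algebraMap_eq R T T[X], ← Ideal.map_map]
    rcases List.mem_append.1 hy with hy | hy
    · obtain ⟨z, hz, rfl⟩ := List.mem_map.1 hy
      exact Ideal.mem_map_of_mem _ (hI z hz)
    · rw [List.mem_singleton.1 hy]
      exact Ideal.map_mono (Ideal.map_mono hJI) hfJ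

end DepthGE

/-! ### Depth of G-class modules and their cosyzygies -/

section GClass

variable {R : Type u} [CommRing R] {M : Type u} [AddCommGroup M] [Module R M] {r : ℕ}

lemma DepthGE.of_isGClass (hR : IsCoherentRing R) {I : Ideal R} [Module.FinitePresentation R M]
    (hM : IsGClass R M) (h : DepthGE I r R) : DepthGE I r M := by
  obtain ⟨S, _, _, _, rs, rfl, hrsI, hrs⟩ := h.exists_isWeaklyRegular
  have := hR.finitePresentation_dual M
  obtain ⟨e, -⟩ := exists_tensor_equiv_hom_dual S M hM.bijective_eval
  rw [(TensorProduct.AlgebraTensorModule.rid R S S).isWeaklyRegular_congr] at hrs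
  have hext := ExtVanish.flat S hR (Module.Dual R M) hM.ext_dual_eq_zero
  exact .of_isWeaklyRegular hrsI ((e.isWeaklyRegular_congr rs).2 (hom_quot_ofList hrs hext).1)

variable [IsLocalRing R]

local notation "𝔪" => IsLocalRing.maximalIdeal R

lemma exists_torsion_of_not_depthGE {T : Type u} [CommRing T] [Algebra R T]
    [Module.FaithfullyFlat R T] {rs : List T} (hI : ∀ y ∈ rs, y ∈ (𝔪).map (algebraMap R T))
    (hrs : IsWeaklyRegular T rs) (h : ¬ DepthGE 𝔪 (rs.length + 1) R) (J : Ideal R) (hJ : J.FG)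
    (hJm : J ≤ 𝔪) :
    ∃ a : T ⧸ (Ideal.ofList rs • ⊤ : Submodule T T), a ≠ 0 ∧ ∀ j ∈ J, j • a = 0 := by
  by_contra hcon
  push Not at hcon
  refine h (.succ_of_forall_eq_zero (TensorProduct.AlgebraTensorModule.rid R T T) hI hrs hJ hJm
    fun a ha => ?_)
  by_contra ha0
  obtain ⟨j, hj, hja⟩ := hcon a ha0
  exact hja (ha j hj)

lemma DepthGE.succ_of_isGClass (hR : IsCoherentRing R) [Nontrivial M]
    [Module.FinitePresentation R M] (hM : IsGClass R M) (h : DepthGE 𝔪 (r + 1) M)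
    (hr : DepthGE 𝔪 r R) : DepthGE 𝔪 (r + 1) R := by
  by_contra hcon
  obtain ⟨T, _, _, _, J, rs, hJ, hJm, rfl, hrsJ, hrs, hgrade⟩ :=
    hr.exists_isWeaklyRegular_gradeGE h
  rw [(TensorProduct.AlgebraTensorModule.rid R T T).isWeaklyRegular_congr] at hrs
  have htors := exists_torsion_of_not_depthGE
    (fun y hy => Ideal.map_mono hJm (hrsJ y hy)) hrs hcon
  have hfp := hR.finitePresentation_dual M
  obtain ⟨e, -⟩ := exists_tensor_equiv_hom_dual T M hM.bijective_eval
  obtain ⟨hreg, hsurj, hker⟩ := hom_quot_ofList hrs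
    (ExtVanish.flat T hR (Module.Dual R M) hM.ext_dual_eq_zero)
  let q : ((Module.Dual R M →ₗ[R] T) ⧸ (Ideal.ofList rs • ⊤ : Submodule T _)) ≃ₗ[T]
      (Module.Dual R M →ₗ[R] T ⧸ (Ideal.ofList rs • ⊤ : Submodule T T)) :=
    Submodule.quotEquivOfEq _ _ hker.symm ≪≫ₗ LinearMap.quotKerEquivOfSurjective _ hsurj
  have hgrade' : GradeGE (J.map (algebraMap R T)) 1
      (Module.Dual R M →ₗ[R] T ⧸ (Ideal.ofList rs • ⊤ : Submodule T T)) := by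
    -- Of the grade `rs.length + 1` of `T ⊗ M`, one unit remains after killing `rs`.
    refine (GradeGE.quot_ofList hreg ((hgrade.congr e).mono le_rfl ?_)).congr q
    rw [add_comm]
  have : Nontrivial (Module.Dual R M) := by
    by_contra hn
    rw [not_nontrivial_iff_subsingleton] at hn
    have : Subsingleton (Module.Dual R (Module.Dual R M)) := inferInstance
    exact not_subsingleton M hM.bijective_eval.1.subsingleton
  let P : Submodule R (Module.Dual R M) := J • ⊤
  have : Module.FinitePresentation R (Module.Dual R M ⧸ P) :=
    Module.finitePresentation_of_surjective P.mkQ P.mkQ_surjective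
      (by rw [Submodule.ker_mkQ]; exact Submodule.FG.smul hJ Module.Finite.fg_top)
  have : Nontrivial (Module.Dual R M ⧸ P) := by
    rw [Submodule.Quotient.nontrivial_iff]
    exact (Submodule.top_ne_ideal_smul_of_le_jacobson_annihilator
      (hJm.trans (IsLocalRing.maximalIdeal_le_jacobson _))).symm
  obtain ⟨φ, hφ⟩ := exists_hom_ne_zero htors (Module.Dual R M ⧸ P)
  -- The composite `M* → M*/JM* → T/rs` is `J`-torsion in a module of grade at least one, hence
  -- zero.
  refine hφ (LinearMap.cancel_right P.mkQ_surjective |>.1 ?_)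
  rw [LinearMap.zero_comp]
  refine hgrade'.eq_zero_of_forall_smul (r := 0) fun a ha => ?_
  ext x
  refine smul_eq_zero_of_mem_map (fun j hj => ?_) ha
  rw [LinearMap.comp_apply, ← map_smul, ← map_smul, P.mkQ_apply,
    (Submodule.Quotient.mk_eq_zero P).2 (Submodule.smul_mem_smul hj trivial), map_zero]

lemma isGClass_or_depthGE_succ (hR : IsCoherentRing R) {k : ℕ} (p : (Fin k → R) →ₗ[R] M)
    (hp : Function.Surjective p) [Module.FinitePresentation R (LinearMap.ker p)]
    (hK : IsGClass R (LinearMap.ker p)) (h : DepthGE 𝔪 r M) (hr : DepthGE 𝔪 r R) :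
    IsGClass R M ∨ DepthGE 𝔪 (r + 1) R := by
  by_contra! hcon
  -- Working with `R × M` provides one sequence regular on both factors.
  obtain ⟨T, _, _, _, rs, rfl, hrsm, hrs⟩ := (hr.prod h).exists_isWeaklyRegular
  have hrsM : IsWeaklyRegular (T ⊗[R] M) rs :=
    isWeaklyRegular_of_retract ((LinearMap.inr R R M).baseChange T)
      ((LinearMap.snd R R M).baseChange T)
      (by rw [← LinearMap.baseChange_comp, LinearMap.snd_comp_inr, LinearMap.baseChange_id]) hrs
  have hrsT : IsWeaklyRegular (T ⊗[R] R) rs :=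
    isWeaklyRegular_of_retract ((LinearMap.inl R R M).baseChange T)
      ((LinearMap.fst R R M).baseChange T)
      (by rw [← LinearMap.baseChange_comp, LinearMap.fst_comp_inl, LinearMap.baseChange_id]) hrs
  rw [(TensorProduct.AlgebraTensorModule.rid R T T).isWeaklyRegular_congr] at hrsT
  have htors := exists_torsion_of_not_depthGE hrsm hrsT hcon.2
  have hF : IsGClass R (Fin k → R) := .of_projective
  let ι := (LinearMap.ker p).subtype
  have hex : Function.Exact ι p := LinearMap.exact_subtype_ker_map p
  refine hcon.1 (.right (Submodule.injective_subtype _) hp hex hK hF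
    (.one_of_extension (Submodule.injective_subtype _) hp hex (.of_projective one_pos) ?_))
  change Function.Surjective ι.dualMap
  rw [← LinearMap.range_eq_top]
  by_contra htop
  have hfp := hR.finitePresentation_dual (LinearMap.ker p)
  have hfpF := hR.finitePresentation_dual (Fin k → R)
  -- The quotient of the dual of `ker p` by `P` is `Ext¹(M, R)`.
  let P := LinearMap.range ι.dualMap
  have : Module.FinitePresentation R (Module.Dual R (LinearMap.ker p) ⧸ P) :=
    Module.finitePresentation_of_surjective P.mkQ P.mkQ_surjective
      (by rw [Submodule.ker_mkQ]; exact Submodule.fg_range _)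
  have : Nontrivial (Module.Dual R (LinearMap.ker p) ⧸ P) :=
    Submodule.Quotient.nontrivial_iff.2 htop
  obtain ⟨φ, hφ⟩ := exists_hom_ne_zero htors (Module.Dual R (LinearMap.ker p) ⧸ P)
  refine hφ (LinearMap.cancel_right P.mkQ_surjective |>.1 ?_)
  rw [LinearMap.zero_comp]
  obtain ⟨-, hsurjK, hkerK⟩ := hom_quot_ofList hrsT
    (ExtVanish.flat T hR _ hK.ext_dual_eq_zero)
  obtain ⟨-, -, hkerF⟩ := hom_quot_ofList hrsT
    (ExtVanish.flat T hR _ hF.ext_dual_eq_zero)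
  obtain ⟨eK, heK⟩ := exists_tensor_equiv_hom_dual T _ hK.bijective_eval
  obtain ⟨eF, heF⟩ := exists_tensor_equiv_hom_dual T _ hF.bijective_eval
  -- The map to `T/rs` lifts to `T`, and reflexivity represents the lift by `κ` in `T ⊗ ker p`.
  obtain ⟨Φ, hΦ⟩ := hsurjK (φ ∘ₗ P.mkQ)
  obtain ⟨κ, rfl⟩ := eK.surjective Φ
  have hnat (z : T ⊗[R] LinearMap.ker p) : eF (ι.baseChange T z) = eK z ∘ₗ ι.dualMap := by
    induction z using TensorProduct.induction_on with
    | zero => simp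
    | tmul t x =>
      ext1 ψ
      rw [LinearMap.baseChange_tmul, heF, LinearMap.comp_apply, heK]
      rfl
    | add x y hx hy => rw [map_add, map_add, map_add, hx, hy, LinearMap.add_comp]
  have hmem : ι.baseChange T κ ∈ (Ideal.ofList rs • ⊤ : Submodule T (T ⊗[R] (Fin k → R))) := by
    have h1 : eF (ι.baseChange T κ) ∈
        (Ideal.ofList rs • ⊤ : Submodule T (Module.Dual R (Fin k → R) →ₗ[R] T)) := by
      rw [← hkerF, LinearMap.mem_ker, hnat]
      ext ψ
      refine (LinearMap.congr_fun hΦ (ι.dualMap ψ)).trans ?_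
      rw [LinearMap.comp_apply, P.mkQ_apply,
        (Submodule.Quotient.mk_eq_zero P).2 (LinearMap.mem_range_self _ ψ), map_zero]
      rfl
    have h2 := Submodule.mem_map_of_mem (f := eF.symm.toLinearMap) h1
    rw [Submodule.map_smul'', LinearEquiv.coe_coe, eF.symm_apply_apply] at h2
    exact Submodule.smul_mono le_rfl le_top h2
  have hinjT : Function.Injective (ι.baseChange T) :=
    Module.Flat.lTensor_preserves_injective_linearMap ι (Submodule.injective_subtype _)
  -- With zero as first map, this says that `T ⊗ ker p → T ⊗ Rᵏ` stays injective modulo `rs`,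
  -- because `rs` is regular on `T ⊗ M`.
  have hfour := map_first_exact_on_four_term_right_exact_of_isSMulRegular_last
    (f₁ := (0 : PUnit.{1} →ₗ[T] T ⊗[R] LinearMap.ker p)) (f₂ := ι.baseChange T)
    (f₃ := p.baseChange T) (fun x => by
      rw [map_eq_zero_iff _ hinjT]
      exact ⟨fun hx => ⟨0, hx.symm⟩, fun ⟨_, hy⟩ => hy.symm⟩)
    (lTensor_exact T hex hp) (LinearMap.lTensor_surjective T hp) hrsM
  obtain ⟨z, hz⟩ := (hfour (Submodule.Quotient.mk κ)).1 (by
    rw [Submodule.mapQ_apply, Submodule.Quotient.mk_eq_zero]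
    exact hmem)
  obtain ⟨z, rfl⟩ := Submodule.Quotient.mk_surjective _ z
  rw [Submodule.mapQ_apply, LinearMap.zero_apply, eq_comm, Submodule.Quotient.mk_zero,
    Submodule.Quotient.mk_eq_zero] at hz
  rw [← hΦ, ← LinearMap.mem_ker, hkerK]
  have h2 := Submodule.mem_map_of_mem (f := eK.toLinearMap) hz
  rw [Submodule.map_smul''] at h2
  exact Submodule.smul_mono le_rfl le_top h2

lemma DepthGE.of_hasGSyzygy (hR : IsCoherentRing R) {n : ℕ} (hM : HasGSyzygy R n M)
    (h : DepthGE 𝔪 (r + n) R) : DepthGE 𝔪 r M := by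
  induction n generalizing M r with
  | zero =>
    have := hM.1
    exact h.of_isGClass hR hM.2
  | succ n ih =>
    obtain ⟨k, p, hp, hK⟩ := hM
    refine .right (Submodule.injective_subtype _) hp (LinearMap.exact_subtype_ker_map p)
      (ih hK (r := r + 1) (h.mono (by lia))) ?_
    exact (h.mono (by lia)).of_isGClass hR .of_projective

lemma DepthGE.add_of_not_hasGRes (hR : IsCoherentRing R) {n : ℕ} (hM : HasGSyzygy R (n + 1) M)
    (hn : ¬ HasGRes R n M) (h : DepthGE 𝔪 r M) : DepthGE 𝔪 (r + (n + 1)) R := by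
  induction n generalizing M r with
  | zero =>
    obtain ⟨k, p, hp, hK⟩ := hM
    have := hK.1
    induction r with
    | zero => exact (isGClass_or_depthGE_succ hR p hp hK.2 h (.zero _ _)).resolve_left hn
    | succ r ih =>
      exact (isGClass_or_depthGE_succ hR p hp hK.2 h (ih (h.mono r.le_succ))).resolve_left hn
  | succ n ihn =>
    obtain ⟨k, p, hp, hK⟩ := hM
    have hex := LinearMap.exact_subtype_ker_map p
    have hinj := Submodule.injective_subtype (LinearMap.ker p)
    have hn' : ¬ HasGRes R n (LinearMap.ker p) := fun hn' =>
      hn ⟨_, _, _, _, _, _, _, p, .of_projective, hinj, hp, hex, hn'⟩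
    have hF {s : ℕ} (hs : DepthGE 𝔪 s R) : DepthGE 𝔪 s (Fin k → R) :=
      hs.of_isGClass hR .of_projective
    -- The inner induction supplies enough depth of `R`, hence of `Rᵏ`, to see that the syzygy is
    -- one deeper than the bound for `M`; the outer hypothesis then applies to the syzygy.
    induction r with
    | zero =>
      have h1 : DepthGE 𝔪 (0 + (n + 1)) R := ihn hK hn' (.zero _ _)
      have h2 : DepthGE 𝔪 1 (LinearMap.ker p) := .left hinj hp hex (hF (h1.mono (by lia))) h
      exact (ihn hK hn' h2).mono (by lia)
    | succ r ih =>
      have h1 : DepthGE 𝔪 (r + 2) R := (ih (h.mono r.le_succ)).mono (by lia)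
      have h2 : DepthGE 𝔪 (r + 2) (LinearMap.ker p) := .left hinj hp hex (hF h1) h
      exact (ihn hK hn' h2).mono (by lia)

lemma DepthGE.of_isGClass_of_nontrivial (hR : IsCoherentRing R) [Nontrivial M]
    [Module.FinitePresentation R M] (hM : IsGClass R M) (h : DepthGE 𝔪 r M) :
    DepthGE 𝔪 r R := by
  induction r with
  | zero => exact .zero _ _
  | succ r ih => exact h.succ_of_isGClass hR hM (ih (h.mono r.le_succ))

end GClass

end GorensteinDim

theorem corollary4p5 (R : Type u) [CommRing R] [IsLocalRing R]
    (hR : GorensteinDim.IsCoherentRing R)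
    (M : Type u) [AddCommGroup M] [Module R M] [Nontrivial M]
    [Module.FinitePresentation R M] (hM : GorensteinDim.Gdim R M ≠ ⊤) :
    GorensteinDim.depth R M + GorensteinDim.Gdim R M = GorensteinDim.depth R R := by
  obtain ⟨n, hn⟩ := ENat.ne_top_iff_exists.1 hM
  have hres : GorensteinDim.HasGRes R n M := (GorensteinDim.gdim_le_iff n).1 hn.ge
  have hsyz := hres.hasGSyzygy hR
  rw [← hn]
  refine GorensteinDim.add_eq_of_forall_natCast_le_iff n fun r => ?_
  rw [GorensteinDim.natCast_le_depth_iff, GorensteinDim.natCast_le_depth_iff]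
  refine ⟨fun h => ?_, fun h => h.of_hasGSyzygy hR hsyz⟩
  cases n with
  | zero => exact h.of_isGClass_of_nontrivial hR hsyz.2
  | succ n =>
    -- The G-dimension is exactly `n + 1`, so a resolution of length `n` is excluded.
    refine h.add_of_not_hasGRes hR hsyz fun hn' => ?_
    have h1 := (GorensteinDim.gdim_le_iff n).2 hn'
    rw [← hn, Nat.cast_le] at h1
    exact absurd h1 (by lia)
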